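/- Let $A$ be a $2\times 2$ integer matrix that is expanding (all its complex eigenvalues have modulus $>1$) and not diagonalizable over $\mathbb{C}$, and let $f_A:\mathbb{T}^2\to\mathbb{T}^2$, $f_A(x+\mathbb{Z}^2)=Ax+\mathbb{Z}^2$, be the induced endomorphism of $\mathbb{T}^2=\mathbb{R}^2/\mathbb{Z}^2$. Then $f_A$ admits a hybrid Markov partition. Here a *Markov partition* for $f_A$ is a finite cover $\mathcal{M}=\{R_1,\dots,R_n\}$ of $\mathbb{T}^2$ by non-empty sets with $R_i=\overline{\operatorname{int}R_i}$ and with pairwise disjoint interiors, such that 1. for every sequence $(x_k)_{k\ge 0}$ in $\{1,\dots,n\}$ the set $\bigcap_{k=0}^\infty f_A^{-k}(\operatorname{int}R_{x_k})$ has at most one point; 2. for all $R,R'\in\mathcal{M}$, if $f_A(\operatorname{int}R)\cap\operatorname{int}R'\neq\emptyset$, then each $y\in\operatorname{int}R'$ has a unique preimage under $f_A$ in $R$. It is *hybrid* if its boundary $\partial\mathcal{M}=\bigcup_{R\in\mathcal{M}}\partial R$ is not piecewise $C^1$ but contains a $C^1$ arc. A subset of $\mathbb{T}^2$ is *piecewise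 $C^1$* if it is a finite union of $C^1$ curves, that is, of images of $C^1$ maps $[0,1]\to\mathbb{T}^2$; a *$C^1$ arc* is the image of an injective $C^1$ map $[0,1]\to\mathbb{T}^2$ with nowhere vanishing derivative. -/

import Mathlib

open Set

noncomputable section

/-- The projection `p : ℝ^d → 𝕋^d = ℝ^d / ℤ^d`. -/
def torusProj {d : ℕ} (x : Fin d → ℝ) : UnitAddTorus (Fin d) :=
  fun i => (x i : UnitAddCircle)

/-- The toral endomorphism `f_A : 𝕋^d → 𝕋^d`, `x + ℤ^d ↦ A x + ℤ^d`, induced by an integer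
matrix `A`. -/
def toralEndo {d : ℕ} (A : Matrix (Fin d) (Fin d) ℤ) (x : UnitAddTorus (Fin d)) :
    UnitAddTorus (Fin d) :=
  fun i => ∑ j, A i j • x j

/-- The defining formula `f_A (x + ℤ^d) = A x + ℤ^d`. -/
theorem toralEndo_torusProj {d : ℕ} (A : Matrix (Fin d) (Fin d) ℤ) (x : Fin d → ℝ) :
    toralEndo A (torusProj x) = torusProj ((A.map (Int.cast : ℤ → ℝ)).mulVec x) := by
  funext i
  have h : ∀ y : Fin d → ℝ,
      ((∑ j, y j : ℝ) : UnitAddCircle) = ∑ j, ((y j : ℝ) : UnitAddCircle) := fun y =>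
    map_sum (QuotientAddGroup.mk' (AddSubgroup.zmultiples (1 : ℝ))) y Finset.univ
  simp only [toralEndo, torusProj, Matrix.mulVec, dotProduct, Matrix.map_apply, h]
  refine Finset.sum_congr rfl fun j _ => ?_
  rw [← zsmul_eq_mul, AddCircle.coe_zsmul]

/-- An integer matrix is expanding if all its (complex) eigenvalues have modulus `> 1`. -/
def IsExpandingMatrix {d : ℕ} (A : Matrix (Fin d) (Fin d) ℤ) : Prop :=
  ∀ μ : ℂ, Module.End.HasEigenvalue (Matrix.toLin' (A.map (Int.cast : ℤ → ℂ))) μ → 1 < ‖μ‖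

/-- An integer matrix is diagonalizable (over `ℂ`): `P⁻¹ A P` is diagonal for some invertible
complex matrix `P`. -/
def IsDiagonalizableMatrix {d : ℕ} (A : Matrix (Fin d) (Fin d) ℤ) : Prop :=
  ∃ P : Matrix (Fin d) (Fin d) ℂ, IsUnit P ∧ (P⁻¹ * A.map (Int.cast : ℤ → ℂ) * P).IsDiag

/-- A set is proper if it is non-empty and the closure of its interior. -/
def IsProperSet {X : Type*} [TopologicalSpace X] (R : Set X) : Prop :=
  R = closure (interior R) ∧ R.Nonempty

/-- `M` is a Markov partition for `f : X → X`. -/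
structure IsMarkovPartition {X : Type*} [TopologicalSpace X] (f : X → X)
    (M : Set (Set X)) : Prop where
  finite : M.Finite
  cover : ⋃₀ M = univ
  proper : ∀ R ∈ M, IsProperSet R
  disjoint_interior : ∀ R ∈ M, ∀ R' ∈ M, R ≠ R' → Disjoint (interior R) (interior R')
  /-- `M` is metrically generating: `⋂ k, f⁻ᵏ (int R_k)` has at most one point for each sequence
  `R_0, R_1, …` of elements of `M`. -/
  generating : ∀ R : ℕ → Set X, (∀ k, R k ∈ M) →
    (⋂ k, (f^[k]) ⁻¹' interior (R k)).Subsingleton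
  /-- The Markov property: if `f (int R)` meets `int R'`, then each point of `int R'` has a unique
  preimage in `R`. -/
  markov : ∀ R ∈ M, ∀ R' ∈ M, (f '' interior R ∩ interior R').Nonempty →
    ∀ y ∈ interior R', ∃! x, x ∈ R ∧ f x = y

/-- The boundary `∂M`, the union of the boundaries of the elements of `M`. -/
def partitionBoundary {X : Type*} [TopologicalSpace X] (M : Set (Set X)) : Set X :=
  ⋃ R ∈ M, frontier R

/-- A `C¹` curve in the torus: the image of `[0,1]` under a `C¹` map to the torus, which is written
through a lift `γ` to `ℝ^d`. -/
def IsC1Curve {d : ℕ} (C : Set (UnitAddTorus (Fin d))) : Prop :=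
  ∃ γ : ℝ → Fin d → ℝ, ContDiffOn ℝ 1 γ (Icc 0 1) ∧ C = (fun t => torusProj (γ t)) '' Icc 0 1

/-- A `C¹` arc in the torus: the image of `[0,1]` under an injective `C¹` map to the torus with
nowhere vanishing derivative, which is written through a lift `γ` to `ℝ^d`. -/
def IsC1Arc {d : ℕ} (C : Set (UnitAddTorus (Fin d))) : Prop :=
  ∃ γ : ℝ → Fin d → ℝ, ContDiffOn ℝ 1 γ (Icc 0 1) ∧
    (∀ t ∈ Icc (0 : ℝ) 1, derivWithin γ (Icc 0 1) t ≠ 0) ∧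
    InjOn (fun t => torusProj (γ t)) (Icc 0 1) ∧
    C = (fun t => torusProj (γ t)) '' Icc 0 1

/-- A set in the torus is piecewise `C¹` if it is a finite union of `C¹` curves. The pieces need
not be injectively or regularly parametrized; in particular every finite union of `C¹` arcs
qualifies. -/
def IsPiecewiseC1 {d : ℕ} (S : Set (UnitAddTorus (Fin d))) : Prop :=
  ∃ 𝒞 : Set (Set (UnitAddTorus (Fin d))), 𝒞.Finite ∧ (∀ C ∈ 𝒞, IsC1Curve C) ∧ S = ⋃₀ 𝒞

/-- A partition of the torus is hybrid if its boundary is not piecewise `C¹`, but contains a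
`C¹` arc. -/
def IsHybrid {d : ℕ} (M : Set (Set (UnitAddTorus (Fin d)))) : Prop :=
  ¬ IsPiecewiseC1 (partitionBoundary M) ∧ ∃ C, IsC1Arc C ∧ C ⊆ partitionBoundary M

end

open Filter Topology

/-- The first `K` symbols of the itinerary of a point with respect to the coding `c`. -/
def itinerary {X κ : Type*} (f : X → X) (c : X → κ) (K : ℕ) (z : X) : Fin K → κ :=
  fun k => c (f^[k] z)

/-- The cell of `z`: the closure of the points of `G` with the same code as `z`. -/
def codeCell {X κ : Type*} [TopologicalSpace X] (G : Set X) (c : X → κ) (z : X) : Set X :=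
  closure {z' | z' ∈ G ∧ c z' = c z}

section Cells

variable {X κ : Type*} [TopologicalSpace X] {G : Set X} {c : X → κ}

theorem mem_interior_codeCell (hG : Dense G)
    (hloc : ∀ z ∈ G, ∀ᶠ z' in 𝓝 z, z' ∈ G → c z' = c z) {w z : X} (hz : z ∈ G)
    (h : c z = c w) : z ∈ interior (codeCell G c w) := by
  obtain ⟨V, hV, hVo, hzV⟩ := eventually_nhds_iff.1 (hloc z hz)
  refine mem_interior.2 ⟨V, ?_, hVo, hzV⟩
  refine (hG.open_subset_closure_inter hVo).trans (closure_mono ?_)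
  rintro y ⟨hy, hyG⟩
  exact ⟨hyG, (hV y hy hyG).trans h⟩

theorem code_eq_of_mem_codeCell (hloc : ∀ z ∈ G, ∀ᶠ z' in 𝓝 z, z' ∈ G → c z' = c z)
    {w z : X} (hz : z ∈ G) (h : z ∈ codeCell G c w) : c z = c w := by
  obtain ⟨V, hV, hVo, hzV⟩ := eventually_nhds_iff.1 (hloc z hz)
  obtain ⟨y, hyV, hyG, hy⟩ := mem_closure_iff.1 h V hVo hzV
  exact (hV y hyV hyG).symm.trans hy

theorem mem_partitionBoundary_codeCell
    (hloc : ∀ z ∈ G, ∀ᶠ z' in 𝓝 z, z' ∈ G → c z' = c z) {z : X}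
    (hz : ∀ V ∈ 𝓝 z, ∃ z₁ ∈ G, ∃ z₂ ∈ G, z₁ ∈ V ∧ z₂ ∈ V ∧ c z₁ ≠ c z₂)
    (hcov : ⋃₀ (codeCell G c '' G) = univ) :
    z ∈ partitionBoundary (codeCell G c '' G) := by
  obtain ⟨R, hR, hzR⟩ := mem_sUnion.1 (hcov ▸ mem_univ z)
  refine mem_iUnion₂.2 ⟨R, hR, ?_⟩
  obtain ⟨w, -, rfl⟩ := hR
  refine ⟨subset_closure hzR, fun hi => ?_⟩
  obtain ⟨z₁, h₁, z₂, h₂, hV₁, hV₂, hne⟩ := hz _ (isOpen_interior.mem_nhds hi)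
  exact hne ((code_eq_of_mem_codeCell hloc h₁ (interior_subset hV₁)).trans
    (code_eq_of_mem_codeCell hloc h₂ (interior_subset hV₂)).symm)

theorem finite_codeCell (hfin : (c '' G).Finite) : (codeCell G c '' G).Finite := by
  refine (hfin.image fun a => closure {z' | z' ∈ G ∧ c z' = a}).subset ?_
  rintro _ ⟨z, hz, rfl⟩
  exact ⟨c z, ⟨z, hz, rfl⟩, rfl⟩

theorem sUnion_codeCell (hG : Dense G) (hfin : (c '' G).Finite) :
    ⋃₀ (codeCell G c '' G) = univ := by
  have hcl : IsClosed (⋃₀ (codeCell G c '' G)) := by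
    rw [sUnion_eq_biUnion]
    refine (finite_codeCell hfin).isClosed_biUnion ?_
    rintro _ ⟨z, -, rfl⟩
    exact isClosed_closure
  refine eq_univ_of_univ_subset (hG.closure_eq ▸ closure_minimal (fun z hz => ?_) hcl)
  exact ⟨_, ⟨z, hz, rfl⟩, subset_closure ⟨hz, rfl⟩⟩

end Cells

section Markov

variable {X κ : Type*} [MetricSpace X] [CompactSpace X] {G : Set X} {c : X → κ} {f : X → X}

theorem isMarkovPartition_codeCell (hf : Continuous f) (hG : Dense G) (hfG : MapsTo f G G)
    (hfin : (c '' G).Finite) (hloc : ∀ z ∈ G, ∀ᶠ z' in 𝓝 z, z' ∈ G → c z' = c z)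
    (hgen : ∀ ε > 0, ∃ n : ℕ, ∀ z ∈ G, ∀ z' ∈ G,
      (∀ k < n, c (f^[k] z) = c (f^[k] z')) → dist z z' ≤ ε)
    (hlift : ∀ z₀ ∈ G, ∀ w ∈ G, c w = c (f z₀) → ∃ z ∈ G, c z = c z₀ ∧ f z = w)
    {ρ : ℝ} (hdiam : ∀ z ∈ G, ∀ z' ∈ G, c z = c z' → dist z z' ≤ ρ)
    (hinj : ∀ x x', dist x x' ≤ ρ → f x = f x' → x = x') :
    IsMarkovPartition f (codeCell G c '' G) where
  finite := finite_codeCell hfin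
  cover := sUnion_codeCell hG hfin
  proper := by
    rintro _ ⟨w, hw, rfl⟩
    refine ⟨subset_antisymm (closure_mono ?_) (closure_minimal interior_subset isClosed_closure),
      w, subset_closure ⟨hw, rfl⟩⟩
    rintro z ⟨hz, h⟩
    exact mem_interior_codeCell hG hloc hz h
  disjoint_interior := by
    rintro _ ⟨w, hw, rfl⟩ _ ⟨w', hw', rfl⟩ hne
    refine disjoint_iff_inter_eq_empty.2 (not_nonempty_iff_eq_empty.1 fun hn => hne ?_)
    obtain ⟨z, ⟨h, h'⟩, hz⟩ := hG.inter_open_nonempty _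
      (isOpen_interior.inter isOpen_interior) hn
    have := (code_eq_of_mem_codeCell hloc hz (interior_subset h)).symm.trans
      (code_eq_of_mem_codeCell hloc hz (interior_subset h'))
    simp only [codeCell, this]
  generating := by
    intro R hR p hp q hq
    choose w hw hRw using hR
    have hfk : ∀ k, MapsTo f^[k] G G := fun k => hfG.iterate k
    refine eq_of_dist_eq_zero (le_antisymm (le_of_forall_pos_le_add fun ε hε => ?_) dist_nonneg)
    obtain ⟨n, hn⟩ := hgen (ε / 3) (by positivity)
    have key : ∀ p ∈ ⋂ k, (f^[k]) ⁻¹' interior (R k),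
        ∃ z ∈ G, dist p z < ε / 3 ∧ ∀ k < n, c (f^[k] z) = c (w k) := by
      intro p hp
      have hopen : IsOpen (Metric.ball p (ε / 3) ∩
          ⋂ k ∈ Iio n, (f^[k]) ⁻¹' interior (R k)) :=
        Metric.isOpen_ball.inter ((finite_Iio n).isOpen_biInter fun k _ =>
          isOpen_interior.preimage (hf.iterate k))
      obtain ⟨z, ⟨h₁, h₂⟩, hz⟩ := hG.inter_open_nonempty _ hopen
        ⟨p, Metric.mem_ball_self (by positivity), mem_iInter₂.2 fun k _ => mem_iInter.1 hp k⟩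
      refine ⟨z, hz, by rwa [dist_comm], fun k hk => ?_⟩
      have := interior_subset (mem_iInter₂.1 h₂ k hk)
      rw [← hRw k] at this
      exact code_eq_of_mem_codeCell hloc (hfk k hz) this
    obtain ⟨z, hz, hpz, hcz⟩ := key p hp
    obtain ⟨z', hz', hqz, hcz'⟩ := key q hq
    have h₁ := hn z hz z' hz' fun k hk => (hcz k hk).trans (hcz' k hk).symm
    have h₂ := dist_triangle4 p z z' q
    rw [dist_comm z' q] at h₂
    linarith
  markov := by
    rintro _ ⟨w, hw, rfl⟩ _ ⟨w', hw', rfl⟩ hne y hy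
    obtain ⟨z₀, hz₀, hc₀, hc₀'⟩ : ∃ z₀ ∈ G, c z₀ = c w ∧ c (f z₀) = c w' := by
      obtain ⟨_, ⟨x, hx, rfl⟩, hx'⟩ := hne
      obtain ⟨z, ⟨h, h'⟩, hz⟩ := hG.inter_open_nonempty _
        (isOpen_interior.inter (isOpen_interior.preimage hf)) ⟨x, hx, hx'⟩
      exact ⟨z, hz, code_eq_of_mem_codeCell hloc hz (interior_subset h),
        code_eq_of_mem_codeCell hloc (hfG hz) (interior_subset h')⟩
    have hex : y ∈ f '' codeCell G c w := by
      have hcl : IsClosed (f '' codeCell G c w) :=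
        (isClosed_closure.isCompact.image hf).isClosed
      refine closure_minimal ?_ hcl (interior_subset hy)
      rintro v ⟨hv, hcv⟩
      obtain ⟨z, hz, hcz, rfl⟩ := hlift z₀ hz₀ v hv (hcv.trans hc₀'.symm)
      exact ⟨z, subset_closure ⟨hz, hcz.trans hc₀⟩, rfl⟩
    obtain ⟨x, hx, hxy⟩ := hex
    refine ⟨x, ⟨hx, hxy⟩, ?_⟩
    rintro x' ⟨hx', hxy'⟩
    refine hinj x' x ?_ (hxy'.trans hxy.symm)
    have hcl : IsClosed {q : X × X | dist q.1 q.2 ≤ ρ} :=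
      isClosed_le (continuous_fst.dist continuous_snd) continuous_const
    have : (x', x) ∈ closure ({z' | z' ∈ G ∧ c z' = c w} ×ˢ {z' | z' ∈ G ∧ c z' = c w}) := by
      rw [closure_prod_eq]
      exact ⟨hx', hx⟩
    refine closure_minimal ?_ hcl this
    rintro ⟨z, z'⟩ ⟨⟨hz, hcz⟩, hz', hcz'⟩
    exact hdiam z hz z' hz' (hcz.trans hcz'.symm)

/-- A locally injective map that is coded on a dense set by a full shift has a Markov partition;
its boundary contains all points at which the code is not locally constant. -/
theorem exists_isMarkovPartition_of_code (hf : Continuous f) (hG : Dense G) (hfG : MapsTo f G G)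
    (hfin : (c '' G).Finite) (hloc : ∀ z ∈ G, ∀ᶠ z' in 𝓝 z, z' ∈ G → c z' = c z)
    (hgen : ∀ ε > 0, ∃ n : ℕ, ∀ z ∈ G, ∀ z' ∈ G,
      (∀ k < n, c (f^[k] z) = c (f^[k] z')) → dist z z' ≤ ε)
    (hlift : ∀ z₀ ∈ G, ∀ w ∈ G, ∃ z ∈ G, c z = c z₀ ∧ f z = w)
    (hinj : ∃ ρ > 0, ∀ x x', dist x x' ≤ ρ → f x = f x' → x = x') :
    ∃ M, IsMarkovPartition f M ∧ ∀ z,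
      (∀ V ∈ 𝓝 z, ∃ z₁ ∈ G, ∃ z₂ ∈ G, z₁ ∈ V ∧ z₂ ∈ V ∧ c z₁ ≠ c z₂) →
        z ∈ partitionBoundary M := by
  obtain ⟨ρ, hρ, hinj⟩ := hinj
  obtain ⟨n, hn⟩ := hgen ρ hρ
  have hfk : ∀ k, MapsTo f^[k] G G := fun k => hfG.iterate k
  have hfin' : (itinerary f c (n + 1) '' G).Finite := by
    refine (Finite.pi' fun _ : Fin (n + 1) => hfin).subset ?_
    rintro _ ⟨z, hz, rfl⟩ k
    exact ⟨_, hfk k hz, rfl⟩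
  have hloc' : ∀ z ∈ G, ∀ᶠ z' in 𝓝 z, z' ∈ G →
      itinerary f c (n + 1) z' = itinerary f c (n + 1) z := by
    intro z hz
    have : ∀ᶠ z' in 𝓝 z, ∀ k : Fin (n + 1), f^[k] z' ∈ G → c (f^[k] z') = c (f^[k] z) :=
      eventually_all.2 fun k =>
        ((hf.iterate k).tendsto z).eventually (hloc _ (hfk k hz))
    filter_upwards [this] with z' h hz'
    funext k
    exact h k (hfk k hz')
  have hhead : ∀ {z z'}, itinerary f c (n + 1) z = itinerary f c (n + 1) z' → c z = c z' :=
    fun h => congrFun h 0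
  refine ⟨codeCell G (itinerary f c (n + 1)) '' G,
    isMarkovPartition_codeCell (ρ := ρ) hf hG hfG hfin' hloc' ?_ ?_ ?_ hinj, fun z hz => ?_⟩
  · intro ε hε
    obtain ⟨N, hN⟩ := hgen ε hε
    exact ⟨N, fun z hz z' hz' h => hN z hz z' hz' fun k hk => hhead (h k hk)⟩
  · intro z₀ hz₀ w hw h
    obtain ⟨z, hz, hcz, rfl⟩ := hlift z₀ hz₀ w hw
    refine ⟨z, hz, ?_, rfl⟩
    funext k
    obtain ⟨_ | k, hk⟩ := k
    · exact hcz
    · have := congrFun h ⟨k, by omega⟩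
      simpa only [itinerary, ← Function.iterate_succ_apply] using this
  · intro z hz z' hz' h
    exact hn z hz z' hz' fun k hk => congrFun h ⟨k, by omega⟩
  · refine mem_partitionBoundary_codeCell hloc' (fun V hV => ?_)
      (sUnion_codeCell hG hfin')
    obtain ⟨z₁, h₁, z₂, h₂, hV₁, hV₂, hne⟩ := hz V hV
    exact ⟨z₁, h₁, z₂, h₂, hV₁, hV₂, fun h => hne (hhead h)⟩

end Markov

section Transport

theorem IsMarkovPartition.image {X Y : Type*} [TopologicalSpace X] [TopologicalSpace Y]
    (e : X ≃ₜ Y) {f : X → X} {g : Y → Y} (h : ∀ x, e (f x) = g (e x)) {M : Set (Set X)}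
    (hM : IsMarkovPartition f M) : IsMarkovPartition g ((fun R => e '' R) '' M) where
  finite := hM.finite.image _
  cover := by
    rw [← image_sUnion, hM.cover, image_univ, e.surjective.range_eq]
  proper := by
    rintro _ ⟨R, hR, rfl⟩
    refine ⟨?_, (hM.proper R hR).2.image e⟩
    simp only [← e.image_interior, ← e.image_closure]
    rw [← (hM.proper R hR).1]
  disjoint_interior := by
    rintro _ ⟨R, hR, rfl⟩ _ ⟨R', hR', rfl⟩ hne
    simp only [← e.image_interior]
    exact (disjoint_image_iff e.injective).2
      (hM.disjoint_interior R hR R' hR' fun h => hne (by rw [h]))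
  generating := by
    intro R hR
    choose S hS hSR using hR
    have hk : ∀ k x, e (f^[k] x) = g^[k] (e x) := fun k =>
      (Function.Semiconj.iterate_right (f := e) h k).eq
    intro p hp q hq
    obtain ⟨p, rfl⟩ := e.surjective p
    obtain ⟨q, rfl⟩ := e.surjective q
    have key : ∀ p, e p ∈ ⋂ k, (g^[k]) ⁻¹' interior (R k) →
        p ∈ ⋂ k, (f^[k]) ⁻¹' interior (S k) := by
      intro p hp
      refine mem_iInter.2 fun k => ?_
      have := mem_iInter.1 hp k
      rw [mem_preimage, ← hk, ← hSR k] at this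
      simp only [← e.image_interior] at this
      obtain ⟨x, hx, hxp⟩ := this
      rwa [mem_preimage, ← e.injective hxp]
    rw [hM.generating S hS (key p hp) (key q hq)]
  markov := by
    rintro _ ⟨R, hR, rfl⟩ _ ⟨R', hR', rfl⟩ hne y hy
    simp only [← e.image_interior] at hne hy
    obtain ⟨y, hy, rfl⟩ := hy
    obtain ⟨_, ⟨_, ⟨x, hx, rfl⟩, rfl⟩, hx'⟩ := hne
    rw [← h, e.injective.mem_set_image] at hx'
    obtain ⟨z, ⟨hz, rfl⟩, huniq⟩ := hM.markov R hR R' hR' ⟨_, mem_image_of_mem f hx, hx'⟩ y hy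
    refine ⟨e z, ⟨mem_image_of_mem e hz, (h z).symm⟩, ?_⟩
    rintro _ ⟨⟨w, hw, rfl⟩, hw'⟩
    rw [huniq w ⟨hw, e.injective (by rw [h, hw'])⟩]

theorem partitionBoundary_image {X Y : Type*} [TopologicalSpace X] [TopologicalSpace Y]
    (e : X ≃ₜ Y) (M : Set (Set X)) :
    partitionBoundary ((fun R => e '' R) '' M) = e '' partitionBoundary M := by
  simp only [partitionBoundary, biUnion_image, image_iUnion₂, e.image_frontier]

variable {d : ℕ}

theorem continuous_toralEndo (A : Matrix (Fin d) (Fin d) ℤ) : Continuous (toralEndo A) := by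
  unfold toralEndo
  fun_prop

theorem toralEndo_mul (A B : Matrix (Fin d) (Fin d) ℤ) (x : UnitAddTorus (Fin d)) :
    toralEndo (A * B) x = toralEndo A (toralEndo B x) := by
  funext i
  simp only [toralEndo, Matrix.mul_apply, Finset.sum_smul, Finset.smul_sum, mul_smul]
  exact Finset.sum_comm

theorem toralEndo_one (x : UnitAddTorus (Fin d)) : toralEndo 1 x = x := by
  funext i
  simp [toralEndo, Matrix.one_apply]

/-- The automorphism of the torus given by an integer matrix with an integer inverse. -/
def toralHomeomorph (P Q : Matrix (Fin d) (Fin d) ℤ) (hPQ : P * Q = 1) (hQP : Q * P = 1) :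
    UnitAddTorus (Fin d) ≃ₜ UnitAddTorus (Fin d) where
  toFun := toralEndo P
  invFun := toralEndo Q
  left_inv x := by rw [← toralEndo_mul, hQP, toralEndo_one]
  right_inv x := by rw [← toralEndo_mul, hPQ, toralEndo_one]
  continuous_toFun := continuous_toralEndo P
  continuous_invFun := continuous_toralEndo Q

theorem contDiffOn_mulVec (P : Matrix (Fin d) (Fin d) ℝ) {γ : ℝ → Fin d → ℝ} {s : Set ℝ}
    (h : ContDiffOn ℝ 1 γ s) : ContDiffOn ℝ 1 (fun t => P.mulVec (γ t)) s :=
  (Matrix.toLin' P).toContinuousLinearMap.contDiff.comp_contDiffOn h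

theorem IsC1Curve.image {C : Set (UnitAddTorus (Fin d))} (h : IsC1Curve C)
    (P : Matrix (Fin d) (Fin d) ℤ) : IsC1Curve (toralEndo P '' C) := by
  obtain ⟨γ, hγ, rfl⟩ := h
  refine ⟨_, contDiffOn_mulVec (P.map (Int.cast : ℤ → ℝ)) hγ, ?_⟩
  rw [image_image]
  simp only [toralEndo_torusProj]

theorem IsC1Arc.image {C : Set (UnitAddTorus (Fin d))} (h : IsC1Arc C)
    {P Q : Matrix (Fin d) (Fin d) ℤ} (hQP : Q * P = 1) : IsC1Arc (toralEndo P '' C) := by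
  obtain ⟨γ, hγ, hder, hinj, rfl⟩ := h
  have hQP' : Q.map (Int.cast : ℤ → ℝ) * P.map (Int.cast : ℤ → ℝ) = 1 := by
    rw [← Matrix.map_mul_intCast, hQP]
    simp
  refine ⟨_, contDiffOn_mulVec (P.map (Int.cast : ℤ → ℝ)) hγ, fun t ht h0 => ?_, ?_, ?_⟩
  · refine hder t ht ?_
    have hd : DifferentiableWithinAt ℝ γ (Icc 0 1) t := hγ.differentiableOn (by simp) t ht
    have hL := ((Matrix.toLin' (P.map (Int.cast : ℤ → ℝ))).toContinuousLinearMap.hasFDerivAt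
      (x := γ t)).comp_hasDerivWithinAt t hd.hasDerivWithinAt
    have h1 := hL.derivWithin (uniqueDiffOn_Icc_zero_one t ht)
    have h2 : (P.map (Int.cast : ℤ → ℝ)).mulVec (derivWithin γ (Icc 0 1) t) = 0 :=
      h1.symm.trans h0
    have h3 := congrArg (Q.map (Int.cast : ℤ → ℝ)).mulVec h2
    rwa [Matrix.mulVec_mulVec, hQP', Matrix.one_mulVec, Matrix.mulVec_zero] at h3
  · intro s hs t ht hst
    refine hinj hs ht ?_
    simp only [← toralEndo_torusProj] at hst
    have := congrArg (toralEndo Q) hst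
    simpa only [← toralEndo_mul, hQP, toralEndo_one] using this
  · rw [image_image]
    simp only [toralEndo_torusProj]

theorem IsPiecewiseC1.image {S : Set (UnitAddTorus (Fin d))} (h : IsPiecewiseC1 S)
    (P : Matrix (Fin d) (Fin d) ℤ) : IsPiecewiseC1 (toralEndo P '' S) := by
  obtain ⟨𝒞, hfin, hC, rfl⟩ := h
  refine ⟨(fun C => toralEndo P '' C) '' 𝒞, hfin.image _, ?_, ?_⟩
  · rintro _ ⟨C, hC', rfl⟩
    exact (hC C hC').image P
  · rw [image_sUnion]

theorem exists_hybrid_of_conj {A B P Q : Matrix (Fin d) (Fin d) ℤ} (hPQ : P * Q = 1)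
    (hQP : Q * P = 1) (hAB : P * B = A * P)
    (h : ∃ M : Set (Set (UnitAddTorus (Fin d))), IsMarkovPartition (toralEndo B) M ∧ IsHybrid M) :
    ∃ M : Set (Set (UnitAddTorus (Fin d))), IsMarkovPartition (toralEndo A) M ∧ IsHybrid M := by
  obtain ⟨M, hM, hpc, C, hC, hCM⟩ := h
  let e := toralHomeomorph P Q hPQ hQP
  refine ⟨_, hM.image e (g := toralEndo A) fun x => ?_, fun hp => hpc ?_,
    toralEndo P '' C, hC.image hQP, ?_⟩
  · change toralEndo P _ = toralEndo A (toralEndo P x)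
    rw [← toralEndo_mul, ← toralEndo_mul, hAB]
  · rw [partitionBoundary_image] at hp
    have := hp.image Q
    change IsPiecewiseC1 (e.symm '' (e '' _)) at this
    rwa [← image_comp, e.symm_comp_self, image_id] at this
  · rw [partitionBoundary_image]
    exact image_mono hCM

end Transport

section NormalForm

open Matrix

theorem isDiagonalizableMatrix_of_conj {A : Matrix (Fin 2) (Fin 2) ℤ}
    {P D : Matrix (Fin 2) (Fin 2) ℂ} (hP : P.det ≠ 0) (hD : D.IsDiag)
    (h : A.map (Int.cast : ℤ → ℂ) * P = P * D) : IsDiagonalizableMatrix A := by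
  have hu : IsUnit P.det := isUnit_iff_ne_zero.2 hP
  refine ⟨P, (Matrix.isUnit_iff_isUnit_det P).2 hu, ?_⟩
  rwa [Matrix.mul_assoc, h, ← Matrix.mul_assoc, Matrix.nonsing_inv_mul P hu, Matrix.one_mul]

theorem disc_eq_zero_of_not_isDiagonalizableMatrix (A : Matrix (Fin 2) (Fin 2) ℤ)
    (hdiag : ¬ IsDiagonalizableMatrix A) :
    (A 0 0 - A 1 1) ^ 2 + 4 * (A 0 1 * A 1 0) = 0 := by
  by_contra hne
  refine hdiag ?_
  have hA : A.map (Int.cast : ℤ → ℂ) = !![(A 0 0 : ℂ), A 0 1; A 1 0, A 1 1] := by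
    ext i j
    fin_cases i <;> fin_cases j <;> rfl
  have hdg : ∀ x y : ℂ, (!![x, 0; 0, y]).IsDiag := by
    intro x y i j hij
    fin_cases i <;> fin_cases j <;> first | rfl | exact absurd rfl hij
  generalize A 0 0 = a at *
  generalize A 0 1 = b at *
  generalize A 1 0 = c at *
  generalize A 1 1 = d at *
  by_cases hb : b = 0
  · subst hb
    have had : (a : ℂ) - d ≠ 0 := by
      intro h
      have : a - d = 0 := by exact_mod_cast h
      simp [this] at hne
    refine isDiagonalizableMatrix_of_conj (P := !![(a : ℂ) - d, 0; c, 1]) (D := !![(a : ℂ), 0; 0, d])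
      (by simpa [det_fin_two] using had) (hdg _ _) ?_
    rw [hA]
    ext i j
    fin_cases i <;> fin_cases j <;> simp [Matrix.mul_apply, Fin.sum_univ_two] <;> ring
  · obtain ⟨s, hs⟩ := IsAlgClosed.exists_pow_nat_eq
      (((a : ℂ) - d) ^ 2 + 4 * (b * c)) (n := 2) (by norm_num)
    have hs0 : s ≠ 0 := by
      rintro rfl
      refine hne ?_
      have : ((a : ℂ) - d) ^ 2 + 4 * (b * c) = 0 := by rw [← hs]; simp
      exact_mod_cast this
    have hb' : (b : ℂ) ≠ 0 := by exact_mod_cast hb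
    refine isDiagonalizableMatrix_of_conj
      (P := !![(b : ℂ), b; (d - a + s) / 2, (d - a - s) / 2])
      (D := !![(a + d + s) / 2, 0; 0, (a + d - s) / 2]) ?_ (hdg _ _) ?_
    · have : (b : ℂ) * ((d - a - s) / 2) - b * ((d - a + s) / 2) = - (b * s) := by ring
      rw [det_fin_two_of, this]
      exact neg_ne_zero.2 (mul_ne_zero hb' hs0)
    · rw [hA]
      ext i j
      fin_cases i <;> fin_cases j <;> simp [Matrix.mul_apply, Fin.sum_univ_two]
      · ring
      · ring
      · linear_combination (-1 / 4 : ℂ) * hs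
      · linear_combination (-1 / 4 : ℂ) * hs

theorem exists_primitive_kernel {e b c : ℤ} (h : e ^ 2 + b * c = 0) :
    ∃ p q r s : ℤ, p * s - q * r = 1 ∧ e * p + b * q = 0 ∧ c * p - e * q = 0 := by
  by_cases h0 : b = 0
  · have he : e = 0 := by
      rw [h0] at h
      simpa using h
    exact ⟨0, 1, -1, 0, by norm_num, by simp [h0], by simp [he]⟩
  · have hg : (0 : ℤ) < Int.gcd b e := by
      exact_mod_cast Int.gcd_pos_of_ne_zero_left e h0
    obtain ⟨p, hp⟩ := Int.gcd_dvd_left b e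
    obtain ⟨q, hq⟩ := Int.gcd_dvd_right b e
    have hbez := Int.gcd_eq_gcd_ab b e
    generalize ((Int.gcd b e : ℕ) : ℤ) = g at *
    generalize Int.gcdA b e = x at hbez
    generalize Int.gcdB b e = y at hbez
    have h1 : p * x + q * y = 1 := by
      refine mul_left_cancel₀ hg.ne' ?_
      linear_combination -hbez - x * hp - y * hq
    refine ⟨p, -q, y, x, by linear_combination h1, ?_, ?_⟩
    · rw [hp, hq]; ring
    · refine mul_left_cancel₀ h0 ?_
      have : g * (c * (p * b) + e * (q * b)) = 0 := by
        linear_combination b * h - c * b * hp - e * b * hq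
      rcases mul_eq_zero.1 this with h | h
      · exact absurd h hg.ne'
      · linear_combination h

theorem exists_normal_form (A : Matrix (Fin 2) (Fin 2) ℤ) (hA : IsExpandingMatrix A)
    (hdiag : ¬ IsDiagonalizableMatrix A) :
    ∃ (l m : ℤ) (P Q : Matrix (Fin 2) (Fin 2) ℤ), 2 ≤ |l| ∧ m ≠ 0 ∧ P * Q = 1 ∧ Q * P = 1 ∧
      P * !![l, m; 0, l] = A * P := by
  have hdisc := disc_eq_zero_of_not_isDiagonalizableMatrix A hdiag
  have hAe : A = !![A 0 0, A 0 1; A 1 0, A 1 1] := Matrix.eta_fin_two A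
  set a := A 0 0
  set b := A 0 1
  set c := A 1 0
  set d := A 1 1
  obtain ⟨e, he⟩ : (2 : ℤ) ∣ a - d := by
    refine Int.prime_two.dvd_of_dvd_pow (n := 2) ⟨-(2 * (b * c)), ?_⟩
    linear_combination hdisc
  have hbc : e ^ 2 + b * c = 0 := by
    rw [he] at hdisc
    linarith [hdisc]
  have ha : a = d + 2 * e := by linarith
  obtain ⟨p, q, r, s, hdet, hk₁, hk₂⟩ := exists_primitive_kernel hbc
  set l := d + e with hl
  set m := s * (e * r + b * s) - r * (c * r - e * s) with hm
  have hPQ : !![p, r; q, s] * !![s, -r; -q, p] = 1 := by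
    rw [Matrix.one_fin_two]
    ext i j
    fin_cases i <;> fin_cases j <;> simp [Matrix.mul_apply, Fin.sum_univ_two] <;>
      linarith
  have hQP : !![s, -r; -q, p] * !![p, r; q, s] = 1 := by
    rw [Matrix.one_fin_two]
    ext i j
    fin_cases i <;> fin_cases j <;> simp [Matrix.mul_apply, Fin.sum_univ_two] <;>
      linarith
  have hconj : !![p, r; q, s] * !![l, m; 0, l] = A * !![p, r; q, s] := by
    rw [hAe, ha]
    ext i j
    fin_cases i <;> fin_cases j <;> simp [Matrix.mul_apply, Fin.sum_univ_two, hl, hm]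
    · linear_combination -hk₁
    · linear_combination (e * r + b * s) * hdet + r * s * hk₁ - r ^ 2 * hk₂
    · linear_combination -hk₂
    · linear_combination (c * r - e * s) * hdet + s ^ 2 * hk₁ - r * s * hk₂
  refine ⟨l, m, _, _, ?_, ?_, hPQ, hQP, hconj⟩
  · have hval : Module.End.HasEigenvalue (Matrix.toLin' (A.map (Int.cast : ℤ → ℂ))) (l : ℂ) := by
      refine Module.End.hasEigenvalue_of_hasEigenvector (x := ![(p : ℂ), q])
        ⟨Module.End.mem_eigenspace_iff.2 ?_, fun h0 => ?_⟩
      · have hk₁' : (e : ℂ) * p + b * q = 0 := by exact_mod_cast hk₁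
        have hk₂' : (c : ℂ) * p - e * q = 0 := by exact_mod_cast hk₂
        rw [hAe, ha, Matrix.toLin'_apply]
        funext i
        fin_cases i <;> simp [Matrix.mulVec, dotProduct, Fin.sum_univ_two, hl]
        · linear_combination hk₁'
        · linear_combination hk₂'
      · have h1 : (p : ℂ) = 0 := congrFun h0 0
        have h2 : (q : ℂ) = 0 := congrFun h0 1
        have h1 : p = 0 := by exact_mod_cast h1
        have h2 : q = 0 := by exact_mod_cast h2
        simp [h1, h2] at hdet
    have h1 := hA _ hval
    rw [Complex.norm_intCast] at h1
    have : 1 < |l| := by exact_mod_cast h1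
    omega
  · intro hm0
    rw [hm0] at hconj
    refine hdiag (isDiagonalizableMatrix_of_conj (P := 1) (D := !![(l : ℂ), 0; 0, l])
      (by simp) ?_ ?_)
    · intro i j hij
      fin_cases i <;> fin_cases j <;> first | rfl | exact absurd rfl hij
    · have : A = !![l, 0; 0, l] := by
        have h2 : !![l, 0; 0, l] = l • (1 : Matrix (Fin 2) (Fin 2) ℤ) := by
          rw [Matrix.one_fin_two]; simp
        have h1 := congrArg (· * !![s, -r; -q, p]) hconj
        simp only [Matrix.mul_assoc, hPQ, Matrix.mul_one] at h1
        rw [← h1, h2, Matrix.smul_mul, Matrix.one_mul, Matrix.mul_smul, hPQ]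
      rw [Matrix.mul_one, Matrix.one_mul, this]
      ext i j
      fin_cases i <;> fin_cases j <;> simp
end NormalForm

noncomputable section

/-- The representative in `[0, 1)` of a point of the circle. -/
def circleFract (t : UnitAddCircle) : ℝ := AddCircle.equivIco (1 : ℝ) 0 t

theorem circleFract_coe (x : ℝ) : circleFract (x : UnitAddCircle) = Int.fract x := by
  have h := AddCircle.coe_equivIco_mk_apply (1 : ℝ) x
  rwa [div_one, mul_one] at h

theorem coe_circleFract (t : UnitAddCircle) : (circleFract t : UnitAddCircle) = t :=
  AddCircle.coe_equivIco

theorem circleFract_nonneg (t : UnitAddCircle) : 0 ≤ circleFract t :=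
  (AddCircle.equivIco (1 : ℝ) 0 t).2.1

theorem circleFract_lt_one (t : UnitAddCircle) : circleFract t < 1 :=
  (AddCircle.equivIco (1 : ℝ) 0 t).2.2.trans_eq (zero_add 1)

theorem continuousAt_circleFract {t : UnitAddCircle} (ht : t ≠ 0) :
    ContinuousAt circleFract t :=
  continuousAt_subtype_val.comp (AddCircle.continuousAt_equivIco (1 : ℝ) 0 (by simpa using ht))

theorem circleFract_zsmul (l : ℤ) (t : UnitAddCircle) :
    circleFract (l • t) = Int.fract (l * circleFract t) := by
  conv_lhs => rw [← coe_circleFract t]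
  rw [← AddCircle.coe_zsmul, circleFract_coe, zsmul_eq_mul]

theorem coe_add_intCast (x : ℝ) (n : ℤ) : ((x + n : ℝ) : UnitAddCircle) = x := by
  have : ((n : ℝ) : UnitAddCircle) = 0 := by
    rw [AddCircle.coe_eq_zero_iff]
    exact ⟨n, by simp⟩
  rw [AddCircle.coe_add, this, add_zero]

/-- The points of infinite order of the circle. -/
def circleIrrational : Set UnitAddCircle := {t | ∀ n : ℤ, n ≠ 0 → n • t ≠ 0}

theorem coe_mem_circleIrrational {x : ℝ} (hx : Irrational x) :
    (x : UnitAddCircle) ∈ circleIrrational := by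
  intro n hn h
  rw [← AddCircle.coe_zsmul, AddCircle.coe_eq_zero_iff] at h
  obtain ⟨k, hk⟩ := h
  refine (hx.intCast_mul hn).ne_int k ?_
  simpa [eq_comm] using hk

theorem irrational_circleFract {t : UnitAddCircle} (ht : t ∈ circleIrrational) :
    Irrational (circleFract t) := by
  rintro ⟨q, hq⟩
  refine ht q.den (by exact_mod_cast q.den_ne_zero) ?_
  rw [← coe_circleFract t, ← AddCircle.coe_zsmul, AddCircle.coe_eq_zero_iff, ← hq]
  refine ⟨q.num, ?_⟩
  simp only [zsmul_eq_mul, mul_one]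
  have := Rat.den_mul_eq_num q
  push_cast
  exact_mod_cast this.symm

theorem zsmul_mem_circleIrrational {l : ℤ} (hl : l ≠ 0) {t : UnitAddCircle}
    (ht : t ∈ circleIrrational) : l • t ∈ circleIrrational := by
  intro n hn
  rw [smul_smul]
  exact ht _ (mul_ne_zero hn hl)

theorem mem_circleIrrational_of_zsmul {l : ℤ} {t : UnitAddCircle}
    (ht : l • t ∈ circleIrrational) : t ∈ circleIrrational := by
  intro n hn h
  refine ht n hn ?_
  rw [smul_comm, h, smul_zero]

theorem dense_circleIrrational : Dense circleIrrational := by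
  have hs : Function.Surjective ((↑) : ℝ → UnitAddCircle) := QuotientAddGroup.mk_surjective
  have h := hs.denseRange.dense_image (AddCircle.continuous_mk' 1) dense_irrational
  refine h.mono ?_
  rintro _ ⟨x, hx, rfl⟩
  exact coe_mem_circleIrrational hx

/-- The index of the interval `[i / b, (i + 1) / b)` containing the point `t` of the circle. -/
def circleDigit (b : ℤ) (t : UnitAddCircle) : ℤ := ⌊b * circleFract t⌋

theorem circleDigit_mem {b : ℤ} (hb : 0 < b) (t : UnitAddCircle) :
    circleDigit b t ∈ Ico 0 b := by
  have hb' : (0 : ℝ) < b := by exact_mod_cast hb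
  refine ⟨Int.floor_nonneg.2 (mul_nonneg hb'.le (circleFract_nonneg t)), Int.floor_lt.2 ?_⟩
  nlinarith [circleFract_lt_one t]

theorem eventually_circleDigit_eq {b : ℤ} (hb : b ≠ 0) {t : UnitAddCircle}
    (ht : t ∈ circleIrrational) : ∀ᶠ t' in 𝓝 t, circleDigit b t' = circleDigit b t := by
  have h0 : t ≠ 0 := by simpa using ht 1 one_ne_zero
  have h1 : Irrational (b * circleFract t) := (irrational_circleFract ht).intCast_mul hb
  have h2 : Tendsto (fun t' => b * circleFract t') (𝓝 t) (𝓝 (b * circleFract t)) :=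
    ((continuousAt_circleFract h0).const_mul (b : ℝ))
  have h3 : Ioo (⌊b * circleFract t⌋ : ℝ) (⌊b * circleFract t⌋ + 1) ∈ 𝓝 (b * circleFract t) :=
    Ioo_mem_nhds (lt_of_le_of_ne (Int.floor_le _) (h1.ne_int _).symm) (Int.lt_floor_add_one _)
  filter_upwards [h2.eventually h3] with t' h
  exact Int.floor_eq_iff.2 ⟨h.1.le, h.2⟩

theorem circleFract_zsmul_sub {l : ℤ} (hl : l ≠ 0) {t t' : UnitAddCircle}
    (ht : t ∈ circleIrrational) (ht' : t' ∈ circleIrrational)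
    (h : circleDigit |l| t = circleDigit |l| t') :
    circleFract (l • t) - circleFract (l • t') = l * (circleFract t - circleFract t') := by
  have hfl : ⌊(l : ℝ) * circleFract t⌋ = ⌊(l : ℝ) * circleFract t'⌋ := by
    rcases abs_cases l with ⟨habs, -⟩ | ⟨habs, -⟩
    · simpa only [circleDigit, habs] using h
    · have key : ∀ {t : UnitAddCircle}, t ∈ circleIrrational →
          ⌊(l : ℝ) * circleFract t⌋ = -circleDigit |l| t - 1 := by
        intro t ht
        have hi : Irrational ((l : ℝ) * circleFract t) := (irrational_circleFract ht).intCast_mul hl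
        rw [circleDigit, habs, Int.cast_neg, neg_mul, Int.floor_neg, neg_neg]
        have h1 : ⌈(l : ℝ) * circleFract t⌉ = ⌊(l : ℝ) * circleFract t⌋ + 1 := by
          refine Int.ceil_eq_iff.2 ⟨?_, ?_⟩
          · push_cast
            simpa using lt_of_le_of_ne (Int.floor_le _) (hi.ne_int _).symm
          · push_cast
            exact (Int.lt_floor_add_one _).le
        rw [h1]; ring
      rw [key ht, key ht', h]
  rw [circleFract_zsmul, circleFract_zsmul, Int.fract, Int.fract, hfl]
  ring

theorem exists_zsmul_eq_circleDigit_eq {l : ℤ} (hl : l ≠ 0) {w : UnitAddCircle}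
    (hw : w ∈ circleIrrational) {i : ℤ} (hi : i ∈ Ico 0 |l|) :
    ∃ t ∈ circleIrrational, l • t = w ∧ circleDigit |l| t = i := by
  have hb : (0 : ℝ) < |(l : ℝ)| := abs_pos.2 (by exact_mod_cast hl)
  have hi0 : (0 : ℝ) ≤ i := by exact_mod_cast hi.1
  have hi1 : (i : ℝ) + 1 ≤ |(l : ℝ)| := by exact_mod_cast hi.2
  have hpos : 0 < circleFract w :=
    lt_of_le_of_ne (circleFract_nonneg w) (by
      have := (irrational_circleFract hw).ne_int 0
      simpa [eq_comm] using this)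
  obtain ⟨s, hs0, hs1, hsw⟩ : ∃ s : ℝ, 0 ≤ s ∧ s < 1 ∧
      ((l * ((i + s) / |(l : ℝ)|) : ℝ) : UnitAddCircle) = w := by
    rcases abs_cases (l : ℝ) with ⟨habs, -⟩ | ⟨habs, -⟩
    · refine ⟨circleFract w, circleFract_nonneg w, circleFract_lt_one w, ?_⟩
      rw [habs] at hb ⊢
      rw [mul_div_cancel₀ _ hb.ne', add_comm, coe_add_intCast, coe_circleFract]
    · refine ⟨1 - circleFract w, by linarith [circleFract_lt_one w], by linarith, ?_⟩
      rw [habs] at hb ⊢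
      have : (l : ℝ) * ((i + (1 - circleFract w)) / -l) =
          circleFract w + ((-i - 1 : ℤ) : ℝ) := by
        have : (l : ℝ) ≠ 0 := by exact_mod_cast hl
        push_cast
        field_simp
        ring
      rw [this, coe_add_intCast, coe_circleFract]
  have hl' : l • (((i + s) / |(l : ℝ)| : ℝ) : UnitAddCircle) = w := by
    rw [← AddCircle.coe_zsmul, zsmul_eq_mul, hsw]
  refine ⟨_, mem_circleIrrational_of_zsmul (l := l) (hl' ▸ hw), hl', ?_⟩
  have hfr : Int.fract ((i + s) / |(l : ℝ)|) = (i + s) / |(l : ℝ)| := by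
    refine Int.fract_eq_self.2 ⟨by positivity, (div_lt_one hb).2 (by linarith)⟩
  rw [circleDigit, circleFract_coe, hfr, Int.cast_abs, mul_div_cancel₀ _ hb.ne']
  exact Int.floor_eq_iff.2 ⟨by linarith, by linarith⟩

/-- The solution of `drift (l • t) = l * drift t + m * circleFract t`. -/
def drift (l m : ℤ) (t : UnitAddCircle) : ℝ :=
  -(m / l) * ∑' k : ℕ, (l : ℝ)⁻¹ ^ k * circleFract (l ^ k • t)

theorem norm_inv_le {l : ℤ} (hl : 2 ≤ |l|) : ‖(l : ℝ)⁻¹‖ ≤ 1 / 2 := by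
  have : (2 : ℝ) ≤ |(l : ℝ)| := by exact_mod_cast hl
  rw [norm_inv, Real.norm_eq_abs, one_div]
  exact inv_anti₀ (by norm_num) this

theorem norm_drift_term_le {l : ℤ} (hl : 2 ≤ |l|) (k : ℕ) {a : ℝ} (ha : a ∈ Icc (0 : ℝ) 1) :
    ‖(l : ℝ)⁻¹ ^ k * a‖ ≤ (1 / 2) ^ k := by
  rw [norm_mul, norm_pow]
  have h1 : ‖a‖ ≤ 1 := by rw [Real.norm_eq_abs, abs_of_nonneg ha.1]; exact ha.2
  have h2 := pow_le_pow_left₀ (norm_nonneg _) (norm_inv_le hl) k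
  calc _ ≤ (1 / 2 : ℝ) ^ k * 1 := by gcongr
    _ = _ := mul_one _

theorem summable_drift {l : ℤ} (hl : 2 ≤ |l|) {a : ℕ → ℝ} (ha : ∀ k, a k ∈ Icc (0 : ℝ) 1) :
    Summable fun k : ℕ => (l : ℝ)⁻¹ ^ k * a k :=
  Summable.of_norm_bounded summable_geometric_two fun k => norm_drift_term_le hl k (ha k)

theorem circleFract_mem_Icc (t : UnitAddCircle) : circleFract t ∈ Icc (0 : ℝ) 1 :=
  ⟨circleFract_nonneg t, (circleFract_lt_one t).le⟩

theorem drift_zsmul {l : ℤ} (hl : 2 ≤ |l|) (m : ℤ) (t : UnitAddCircle) :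
    drift l m (l • t) = l * drift l m t + m * circleFract t := by
  have hl0 : (l : ℝ) ≠ 0 := by
    rintro h
    have : l = 0 := by exact_mod_cast h
    simp [this] at hl
  have h := (summable_drift hl (a := fun k => circleFract (l ^ k • t))
    fun k => circleFract_mem_Icc _).tsum_eq_zero_add
  have h2 : ∀ k : ℕ, (l : ℝ)⁻¹ ^ (k + 1) * circleFract (l ^ (k + 1) • t) =
      (l : ℝ)⁻¹ * ((l : ℝ)⁻¹ ^ k * circleFract (l ^ k • l • t)) := by
    intro k
    rw [smul_smul, ← pow_succ]
    ring
  simp only [h2, tsum_mul_left, pow_zero, one_smul, one_mul] at h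
  rw [drift, drift, h]
  field_simp
  ring

theorem tendsto_drift {l : ℤ} (hl : 2 ≤ |l|) (m : ℤ) {α : Type*} {F : Filter α}
    {g : α → UnitAddCircle} {a : ℕ → ℝ}
    (h : ∀ k, Tendsto (fun x => circleFract (l ^ k • g x)) F (𝓝 (a k))) :
    Tendsto (fun x => drift l m (g x)) F (𝓝 (-(m / l) * ∑' k : ℕ, (l : ℝ)⁻¹ ^ k * a k)) := by
  refine Tendsto.const_mul _ (tendsto_tsum_of_dominated_convergence summable_geometric_two
    (fun k => (h k).const_mul _) (Eventually.of_forall fun x k => ?_))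
  exact norm_drift_term_le hl k (circleFract_mem_Icc _)

theorem continuousAt_drift {l : ℤ} (hl : 2 ≤ |l|) (m : ℤ) {t : UnitAddCircle}
    (ht : t ∈ circleIrrational) :
    ContinuousAt (drift l m) t := by
  have hl0 : l ≠ 0 := by rintro rfl; simp at hl
  refine tendsto_drift hl m (g := id) fun k => ?_
  exact (continuousAt_circleFract (ht _ (pow_ne_zero k hl0))).comp
    (f := fun t : UnitAddCircle => l ^ k • t) (by fun_prop)

theorem abs_drift_sub_le {l : ℤ} (hl : 2 ≤ |l|) (m : ℤ) (t t' : UnitAddCircle) :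
    |drift l m t - drift l m t'| ≤ 2 * |(m : ℝ)| := by
  have key : ∀ t, |drift l m t| ≤ |(m : ℝ)| := by
    intro t
    have h1 : |∑' k : ℕ, (l : ℝ)⁻¹ ^ k * circleFract (l ^ k • t)| ≤ 2 := by
      refine tsum_of_norm_bounded (f := fun k : ℕ => (l : ℝ)⁻¹ ^ k * circleFract (l ^ k • t))
        hasSum_geometric_two fun k => norm_drift_term_le hl k (circleFract_mem_Icc _)
    have h2 : |(l : ℝ)⁻¹| ≤ 1 / 2 := norm_inv_le hl
    rw [drift, abs_mul, abs_neg, div_eq_mul_inv, abs_mul]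
    calc _ ≤ |(m : ℝ)| * (1 / 2) * 2 := by gcongr
      _ = _ := by ring
  have := abs_sub (drift l m t) (drift l m t')
  linarith [key t, key t']

theorem abs_sub_le_of_circleDigit_eq {l : ℤ} (hl : 2 ≤ |l|) (m : ℤ) (n : ℕ) :
    ∀ t ∈ circleIrrational, ∀ t' ∈ circleIrrational,
    (∀ k < n, circleDigit |l| (l ^ k • t) = circleDigit |l| (l ^ k • t')) →
    |circleFract t - circleFract t'| ≤ (1 / 2) ^ n ∧
      |drift l m t - drift l m t'| ≤ |(m : ℝ)| * ((2 + n) * (1 / 2) ^ n) := by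
  have hl0 : l ≠ 0 := by rintro rfl; simp at hl
  have hl0' : (l : ℝ) ≠ 0 := by exact_mod_cast hl0
  have hinv : |(l : ℝ)⁻¹| ≤ 1 / 2 := norm_inv_le hl
  induction n with
  | zero =>
    intro t _ t' _ _
    refine ⟨?_, ?_⟩
    · rw [pow_zero, abs_sub_le_iff]
      constructor <;> linarith [circleFract_nonneg t, circleFract_nonneg t', circleFract_lt_one t,
        circleFract_lt_one t']
    · simpa [mul_comm] using abs_drift_sub_le hl m t t'
  | succ n ih =>
    intro t ht t' ht' h
    obtain ⟨ih₁, ih₂⟩ := ih (l • t) (zsmul_mem_circleIrrational hl0 ht) (l • t')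
      (zsmul_mem_circleIrrational hl0 ht') fun k hk => by
        simpa only [smul_smul, ← pow_succ] using h (k + 1) (by omega)
    have h0 := h 0 (by omega)
    simp only [pow_zero, one_smul] at h0
    have h1 : circleFract t - circleFract t' =
        (l : ℝ)⁻¹ * (circleFract (l • t) - circleFract (l • t')) := by
      rw [circleFract_zsmul_sub hl0 ht ht' h0, inv_mul_cancel_left₀ hl0']
    have h2 : drift l m t - drift l m t' = (l : ℝ)⁻¹ *
        ((drift l m (l • t) - drift l m (l • t')) - m * (circleFract t - circleFract t')) := by
      rw [drift_zsmul hl, drift_zsmul hl]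
      field_simp
      ring
    have h3 : |circleFract t - circleFract t'| ≤ (1 / 2) ^ (n + 1) := by
      rw [h1, abs_mul, pow_succ']
      gcongr
    refine ⟨h3, ?_⟩
    rw [h2, abs_mul]
    have h4 := abs_sub (drift l m (l • t) - drift l m (l • t'))
      (m * (circleFract t - circleFract t'))
    rw [abs_mul] at h4
    have h5 : |(m : ℝ)| * |circleFract t - circleFract t'| ≤ |(m : ℝ)| * (1 / 2) ^ n := by
      gcongr
      refine h3.trans ?_
      rw [pow_succ']
      have : (0 : ℝ) ≤ (1 / 2) ^ n := by positivity
      linarith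
    calc _ ≤ 1 / 2 * (|(m : ℝ)| * ((2 + n) * (1 / 2) ^ n) + |(m : ℝ)| * (1 / 2) ^ n) := by
          gcongr
          linarith
      _ = _ := by push_cast; ring

theorem dist_coe_le (x y : ℝ) : dist (x : UnitAddCircle) y ≤ |x - y| := by
  rw [dist_eq_norm, ← AddCircle.coe_sub]
  exact QuotientAddGroup.norm_mk_le_norm

theorem dist_le_abs_circleFract_sub (t t' : UnitAddCircle) :
    dist t t' ≤ |circleFract t - circleFract t'| := by
  simpa only [coe_circleFract] using dist_coe_le (circleFract t) (circleFract t')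

theorem eq_zero_of_zsmul_eq_zero {l : ℤ} (hl : l ≠ 0) {t : UnitAddCircle} (h : l • t = 0)
    (ht : ‖t‖ ≤ 1 / (2 * |(l : ℝ)|)) : t = 0 := by
  by_contra h0
  have hl' : 0 < |(l : ℝ)| := abs_pos.2 (by exact_mod_cast hl)
  have hn : l.natAbs • t = 0 := by
    rcases Int.natAbs_eq l with h' | h'
    · rw [h'] at h; simpa using h
    · rw [h', neg_smul, neg_eq_zero] at h; simpa using h
  have hfin : IsOfFinAddOrder t :=
    isOfFinAddOrder_iff_nsmul_eq_zero.2 ⟨_, Int.natAbs_pos.2 hl, hn⟩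
  have h1 := AddCircle.le_add_order_smul_norm_of_isOfFinAddOrder hfin h0
  have h2 : (addOrderOf t : ℝ) ≤ |(l : ℝ)| := by
    have := Nat.le_of_dvd (Int.natAbs_pos.2 hl) (addOrderOf_dvd_of_nsmul_eq_zero hn)
    rw [← Int.cast_abs, ← Nat.cast_natAbs]
    exact_mod_cast this
  rw [nsmul_eq_mul] at h1
  have h3 : (addOrderOf t : ℝ) * ‖t‖ ≤ |(l : ℝ)| * (1 / (2 * |(l : ℝ)|)) := by gcongr
  have h4 : |(l : ℝ)| * (1 / (2 * |(l : ℝ)|)) = 1 / 2 := by field_simp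
  linarith

/-- The coordinate in which the map `(x, y) ↦ (l x + m y, l y)` becomes multiplication by `l`. -/
def shear (l m : ℤ) (z : UnitAddTorus (Fin 2)) : UnitAddCircle := z 0 - (drift l m (z 1) : ℝ)

/-- The points of the torus whose second and sheared first coordinates have infinite order. -/
def shearIrrational (l m : ℤ) : Set (UnitAddTorus (Fin 2)) :=
  {z | z 1 ∈ circleIrrational ∧ shear l m z ∈ circleIrrational}

/-- The leading digits in base `|l|` of the sheared coordinates. -/
def shearCode (l m : ℤ) (z : UnitAddTorus (Fin 2)) : ℤ × ℤ :=
  (circleDigit |l| (shear l m z), circleDigit |l| (z 1))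

theorem toralEndo_upper_zero (l m : ℤ) (z : UnitAddTorus (Fin 2)) :
    toralEndo !![l, m; 0, l] z 0 = l • z 0 + m • z 1 := by
  simp [toralEndo, Fin.sum_univ_two]

theorem toralEndo_upper_one (l m : ℤ) (z : UnitAddTorus (Fin 2)) :
    toralEndo !![l, m; 0, l] z 1 = l • z 1 := by
  simp [toralEndo, Fin.sum_univ_two]

theorem shear_toralEndo {l : ℤ} (hl : 2 ≤ |l|) (m : ℤ) (z : UnitAddTorus (Fin 2)) :
    shear l m (toralEndo !![l, m; 0, l] z) = l • shear l m z := by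
  rw [shear, shear, toralEndo_upper_zero, toralEndo_upper_one, drift_zsmul hl, AddCircle.coe_add,
    ← zsmul_eq_mul, ← zsmul_eq_mul, AddCircle.coe_zsmul, AddCircle.coe_zsmul, coe_circleFract,
    smul_sub]
  abel

theorem iterate_toralEndo_upper_one (l m : ℤ) (k : ℕ) (z : UnitAddTorus (Fin 2)) :
    ((toralEndo !![l, m; 0, l])^[k] z) 1 = l ^ k • z 1 := by
  induction k with
  | zero => simp
  | succ k ih => rw [Function.iterate_succ_apply', toralEndo_upper_one, ih, smul_smul, pow_succ']

theorem shear_iterate_toralEndo {l : ℤ} (hl : 2 ≤ |l|) (m : ℤ) (k : ℕ)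
    (z : UnitAddTorus (Fin 2)) :
    shear l m ((toralEndo !![l, m; 0, l])^[k] z) = l ^ k • shear l m z := by
  induction k with
  | zero => simp
  | succ k ih => rw [Function.iterate_succ_apply', shear_toralEndo hl, ih, smul_smul, pow_succ']

theorem continuous_pair {X Y : Type*} [TopologicalSpace X] [TopologicalSpace Y] {f g : X → Y}
    (hf : Continuous f) (hg : Continuous g) : Continuous fun x => ![f x, g x] := by
  refine continuous_pi fun i => ?_
  fin_cases i
  exacts [hf, hg]

theorem exists_sub_mem_circleIrrational {U : Set UnitAddCircle} (hU : IsOpen U)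
    (hne : U.Nonempty) (a : UnitAddCircle) : ∃ x ∈ U, x - a ∈ circleIrrational := by
  have := dense_circleIrrational.preimage (Homeomorph.subRight a).isOpenMap
  exact this.inter_open_nonempty U hU hne

theorem dense_shearIrrational (l m : ℤ) : Dense (shearIrrational l m) := by
  refine dense_iff_inter_open.2 fun V hV ⟨z, hz⟩ => ?_
  have h1 : IsOpen {t : UnitAddCircle | ![z 0, t] ∈ V} :=
    hV.preimage (continuous_pair continuous_const continuous_id)
  obtain ⟨t, htV, ht⟩ := dense_circleIrrational.inter_open_nonempty _ h1 ⟨z 1, by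
    rw [mem_ofPred_eq]
    convert hz
    ext i
    fin_cases i <;> rfl⟩
  have h2 : IsOpen {x : UnitAddCircle | ![x, t] ∈ V} :=
    hV.preimage (continuous_pair continuous_id continuous_const)
  obtain ⟨x, hxV, hx⟩ := exists_sub_mem_circleIrrational h2 ⟨z 0, htV⟩ (drift l m t : ℝ)
  exact ⟨![x, t], hxV, ht, hx⟩

/-- If the drift converges to `v` along a filter `F` that converges to `t`, then near the point
`(x, t)` there are points whose second coordinate is controlled by `F` and whose sheared first
coordinate is close to `x - v`. -/
theorem exists_shearIrrational_near {l m : ℤ} {F : Filter UnitAddCircle} {x t : UnitAddCircle}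
    {v : ℝ} (hF : F ≤ 𝓝 t) (hirr : ∃ᶠ t' in F, t' ∈ circleIrrational)
    (hv : Tendsto (drift l m) F (𝓝 v)) {O : Set UnitAddCircle} (hO : IsOpen O)
    (hxO : x - (v : UnitAddCircle) ∈ O) {V : Set (UnitAddTorus (Fin 2))} (hV : V ∈ 𝓝 ![x, t]) :
    ∃ z ∈ shearIrrational l m, z ∈ V ∧ shear l m z ∈ O := by
  obtain ⟨W, hWV, hW, hxW⟩ := mem_nhds_iff.1 hV
  have h1 : ∀ᶠ t' in F, ![x, t'] ∈ W :=
    hF ((hW.preimage (continuous_pair continuous_const continuous_id)).mem_nhds hxW)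
  have h2 : ∀ᶠ t' in F, x - (drift l m t' : UnitAddCircle) ∈ O := by
    have : Tendsto (fun t' => x - (drift l m t' : UnitAddCircle)) F (𝓝 (x - v)) :=
      (((AddCircle.continuous_mk' 1).tendsto v).comp hv).const_sub x
    exact this (hO.mem_nhds hxO)
  obtain ⟨t', ht', hW', hO'⟩ := (hirr.and_eventually (h1.and h2)).exists
  have h3 : IsOpen ({y : UnitAddCircle | ![y, t'] ∈ W} ∩
      {y : UnitAddCircle | y - (drift l m t' : UnitAddCircle) ∈ O}) :=
    (hW.preimage (continuous_pair continuous_id continuous_const)).inter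
      (hO.preimage (continuous_id.sub continuous_const))
  obtain ⟨y, ⟨hyW, hyO⟩, hy⟩ := exists_sub_mem_circleIrrational h3 ⟨x, hW', hO'⟩ (drift l m t' : ℝ)
  exact ⟨![y, t'], ⟨ht', hy⟩, hWV hyW, hyO⟩

theorem exists_isMarkovPartition_upper {l : ℤ} (hl : 2 ≤ |l|) (m : ℤ) :
    ∃ M, IsMarkovPartition (toralEndo !![l, m; 0, l]) M ∧ ∀ z,
      (∀ V ∈ 𝓝 z, ∃ z₁ ∈ shearIrrational l m, ∃ z₂ ∈ shearIrrational l m, z₁ ∈ V ∧ z₂ ∈ V ∧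
        shearCode l m z₁ ≠ shearCode l m z₂) → z ∈ partitionBoundary M := by
  have hl0 : l ≠ 0 := by rintro rfl; simp at hl
  have hb : 0 < |l| := by omega
  refine exists_isMarkovPartition_of_code (continuous_toralEndo _) (dense_shearIrrational l m)
    ?_ ?_ ?_ ?_ ?_ ?_
  · rintro z ⟨h1, h2⟩
    refine ⟨?_, ?_⟩
    · rw [toralEndo_upper_one]
      exact zsmul_mem_circleIrrational hl0 h1
    · rw [shear_toralEndo hl]
      exact zsmul_mem_circleIrrational hl0 h2
  · refine ((finite_Ico (0 : ℤ) |l|).prod (finite_Ico (0 : ℤ) |l|)).subset ?_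
    rintro _ ⟨z, -, rfl⟩
    exact ⟨circleDigit_mem hb _, circleDigit_mem hb _⟩
  · rintro z ⟨h1, h2⟩
    have hc1 : Tendsto (fun z' : UnitAddTorus (Fin 2) => z' 1) (𝓝 z) (𝓝 (z 1)) :=
      (continuous_apply 1).tendsto z
    have hc2 : Tendsto (shear l m) (𝓝 z) (𝓝 (shear l m z)) := by
      refine ((continuous_apply 0).tendsto z).sub ?_
      exact ((AddCircle.continuous_mk' 1).tendsto _).comp
        ((continuousAt_drift hl m h1).tendsto.comp hc1)
    filter_upwards [hc1.eventually (eventually_circleDigit_eq hb.ne' h1),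
      hc2.eventually (eventually_circleDigit_eq hb.ne' h2)] with z' h3 h4 _
    exact Prod.ext h4 h3
  · intro ε hε
    have hlim : Tendsto (fun n : ℕ => (1 / 2 : ℝ) ^ n +
        |(m : ℝ)| * ((2 + n) * (1 / 2) ^ n)) atTop (𝓝 0) := by
      have h1 := tendsto_pow_atTop_nhds_zero_of_lt_one (r := (1 / 2 : ℝ)) (by norm_num)
        (by norm_num)
      have h2 := tendsto_self_mul_const_pow_of_lt_one (r := (1 / 2 : ℝ)) (by norm_num)
        (by norm_num)
      have h3 := h1.add (((h1.const_mul 2).add h2).const_mul |(m : ℝ)|)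
      simp only [mul_zero, add_zero] at h3
      refine h3.congr fun n => ?_
      ring
    obtain ⟨n, hn⟩ := (hlim.eventually (gt_mem_nhds hε)).exists
    refine ⟨n, fun z hz z' hz' h => ?_⟩
    simp only [shearCode, shear_iterate_toralEndo hl, iterate_toralEndo_upper_one,
      Prod.mk.injEq] at h
    obtain ⟨hs, -⟩ := abs_sub_le_of_circleDigit_eq hl m n _ hz.2 _ hz'.2 fun k hk => (h k hk).1
    obtain ⟨ht, hd⟩ := abs_sub_le_of_circleDigit_eq hl m n _ hz.1 _ hz'.1 fun k hk => (h k hk).2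
    have hpos : 0 ≤ |(m : ℝ)| * ((2 + n) * (1 / 2) ^ n) := by positivity
    refine (dist_pi_le_iff hε.le).2 fun i => ?_
    fin_cases i
    · have h0 : ∀ z, z 0 = shear l m z + (drift l m (z 1) : ℝ) := fun z =>
        (sub_add_cancel _ _).symm
      have h1 := dist_add_add_le (shear l m z) (drift l m (z 1) : UnitAddCircle) (shear l m z')
        (drift l m (z' 1) : UnitAddCircle)
      rw [← h0, ← h0] at h1
      have h2 := dist_le_abs_circleFract_sub (shear l m z) (shear l m z')
      have h3 := dist_coe_le (drift l m (z 1)) (drift l m (z' 1))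
      change dist (z 0) (z' 0) ≤ ε
      linarith
    · have h2 := dist_le_abs_circleFract_sub (z 1) (z' 1)
      change dist (z 1) (z' 1) ≤ ε
      linarith
  · rintro z₀ - w ⟨hw1, hw2⟩
    obtain ⟨t, ht, hlt, hdt⟩ := exists_zsmul_eq_circleDigit_eq hl0 hw1
      (circleDigit_mem hb (z₀ 1))
    obtain ⟨s, hs, hls, hds⟩ := exists_zsmul_eq_circleDigit_eq hl0 hw2
      (circleDigit_mem hb (shear l m z₀))
    have hsh : shear l m ![s + (drift l m t : ℝ), t] = s := add_sub_cancel_right _ _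
    refine ⟨![s + (drift l m t : ℝ), t], ⟨ht, mem_of_eq_of_mem hsh hs⟩, ?_, ?_⟩
    · rw [shearCode, hsh]
      exact Prod.ext hds hdt
    · have h1 := toralEndo_upper_one l m ![s + (drift l m t : ℝ), t]
      have h1' : toralEndo !![l, m; 0, l] ![s + (drift l m t : ℝ), t] 1 = w 1 := h1.trans hlt
      have h2 := shear_toralEndo hl m ![s + (drift l m t : ℝ), t]
      rw [hsh, hls, shear, shear, h1', sub_left_inj] at h2
      ext i
      fin_cases i
      exacts [h2, h1']
  · refine ⟨1 / (2 * |(l : ℝ)|), ?_, fun z z' hd hz => ?_⟩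
    · have : 0 < |(l : ℝ)| := abs_pos.2 (by exact_mod_cast hl0)
      positivity
    · have hd' : ∀ i, ‖z i - z' i‖ ≤ 1 / (2 * |(l : ℝ)|) := fun i => by
        rw [← dist_eq_norm]
        exact (dist_le_pi_dist z z' i).trans hd
      have h1 : z 1 - z' 1 = 0 := by
        refine eq_zero_of_zsmul_eq_zero hl0 ?_ (hd' 1)
        rw [smul_sub, sub_eq_zero, ← toralEndo_upper_one l m, ← toralEndo_upper_one l m, hz]
      have h0 : z 0 - z' 0 = 0 := by
        refine eq_zero_of_zsmul_eq_zero hl0 ?_ (hd' 0)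
        have := congrFun hz 0
        rw [toralEndo_upper_zero, toralEndo_upper_zero, sub_eq_zero.1 h1] at this
        rw [smul_sub, sub_eq_zero]
        exact add_right_cancel this
      ext i
      fin_cases i
      exacts [sub_eq_zero.1 h0, sub_eq_zero.1 h1]

end

section Length

open MeasureTheory Measure

theorem exists_lipschitzOnWith_of_contDiffOn_Icc {E : Type*} [NormedAddCommGroup E]
    [NormedSpace ℝ E] {γ : ℝ → E} (h : ContDiffOn ℝ 1 γ (Icc 0 1)) :
    ∃ K, LipschitzOnWith K γ (Icc 0 1) := by
  have hc : ContinuousOn (derivWithin γ (Icc 0 1)) (Icc 0 1) :=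
    h.continuousOn_derivWithin uniqueDiffOn_Icc_zero_one le_rfl
  obtain ⟨C, hC⟩ := isCompact_Icc.exists_bound_of_continuousOn hc
  refine ⟨C.toNNReal, (convex_Icc 0 1).lipschitzOnWith_of_nnnorm_derivWithin_le
    (h.differentiableOn (by simp)) fun t ht => ?_⟩
  exact NNReal.le_toNNReal_of_coe_le (hC t ht)

theorem lipschitzWith_torusProj {d : ℕ} : LipschitzWith 1 (torusProj (d := d)) := by
  refine LipschitzWith.of_dist_le_mul fun x y => ?_
  rw [NNReal.coe_one, one_mul, dist_pi_le_iff dist_nonneg]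
  intro i
  refine (dist_coe_le (x i) (y i)).trans ?_
  rw [← Real.dist_eq]
  exact dist_le_pi_dist x y i

theorem IsC1Curve.hausdorffMeasure_lt_top {d : ℕ} {C : Set (UnitAddTorus (Fin d))}
    (h : IsC1Curve C) : μH[1] C < ⊤ := by
  obtain ⟨γ, hγ, rfl⟩ := h
  obtain ⟨K, hK⟩ := exists_lipschitzOnWith_of_contDiffOn_Icc hγ
  have h1 := (lipschitzWith_torusProj.comp_lipschitzOnWith hK).hausdorffMeasure_image_le
    zero_le_one
  refine h1.trans_lt ?_
  rw [hausdorffMeasure_real, Real.volume_Icc]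
  simp

theorem IsPiecewiseC1.hausdorffMeasure_lt_top {d : ℕ} {S : Set (UnitAddTorus (Fin d))}
    (h : IsPiecewiseC1 S) : μH[1] S < ⊤ := by
  obtain ⟨𝒞, hfin, hC, rfl⟩ := h
  rw [sUnion_eq_biUnion]
  exact measure_biUnion_lt_top hfin fun C hC' => (hC C hC').hausdorffMeasure_lt_top

/-- The horizontal segment `[c, c + δ] × {y}` in the torus. -/
def horizontalSegment (c δ y : ℝ) : Set (UnitAddTorus (Fin 2)) :=
  (fun x : ℝ => torusProj ![x, y]) '' Icc c (c + δ)

theorem hausdorffMeasure_horizontalSegment (c y : ℝ) {δ : ℝ} (hδ : δ ≤ 1 / 2) :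
    μH[1] (horizontalSegment c δ y) = ENNReal.ofReal δ := by
  have hiso : Isometry fun x : Icc c (c + δ) => torusProj ![(x : ℝ), y] := by
    refine Isometry.of_dist_eq fun x x' => ?_
    have h0 : dist ((x : ℝ) : UnitAddCircle) ((x' : ℝ) : UnitAddCircle) = dist x x' := by
      rw [dist_eq_norm, ← AddCircle.coe_sub, Subtype.dist_eq, Real.dist_eq,
        AddCircle.norm_coe_eq_abs_iff _ one_ne_zero, abs_one, abs_le]
      constructor <;> linarith [x.2.1, x.2.2, x'.2.1, x'.2.2]
    refine le_antisymm ((dist_pi_le_iff dist_nonneg).2 fun i => ?_) (h0.symm.le.trans ?_)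
    · fin_cases i
      · exact h0.le
      · exact (dist_self (y : UnitAddCircle)).le.trans dist_nonneg
    · exact dist_le_pi_dist (torusProj ![(x : ℝ), y]) (torusProj ![(x' : ℝ), y]) 0
  have himg : horizontalSegment c δ y =
      (fun x : Icc c (c + δ) => torusProj ![(x : ℝ), y]) '' univ := by
    rw [horizontalSegment, image_univ, image_eq_range]
  have huniv : Icc c (c + δ) = ((↑) : Icc c (c + δ) → ℝ) '' univ := by
    rw [image_univ, Subtype.range_coe]
  rw [himg, hiso.hausdorffMeasure_image (Or.inl zero_le_one),
    ← isometry_subtype_coe.hausdorffMeasure_image (Or.inl zero_le_one), ← huniv,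
    hausdorffMeasure_real, Real.volume_Icc, add_sub_cancel_left]

theorem continuous_torusProj_pair (y : ℝ) : Continuous fun x : ℝ => torusProj ![x, y] :=
  lipschitzWith_torusProj.continuous.comp (continuous_pair continuous_id continuous_const)

theorem sum_le_hausdorffMeasure_of_horizontalSegment_subset {ι : Type*} (s : Finset ι)
    {c δ y : ι → ℝ} {S : Set (UnitAddTorus (Fin 2))} (hδ : ∀ i ∈ s, δ i ≤ 1 / 2)
    (hy : ∀ i ∈ s, y i ∈ Ico (0 : ℝ) 1) (hinj : InjOn y s)
    (hS : ∀ i ∈ s, horizontalSegment (c i) (δ i) (y i) ⊆ S) :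
    ENNReal.ofReal (∑ i ∈ s, δ i) ≤ μH[1] S := by
  have hdisj : (s : Set ι).PairwiseDisjoint fun i => horizontalSegment (c i) (δ i) (y i) := by
    intro i hi j hj hne
    refine disjoint_left.2 ?_
    rintro _ ⟨x, -, rfl⟩ ⟨x', -, h⟩
    refine hne (hinj hi hj ?_)
    have h1 : ((y j : ℝ) : UnitAddCircle) = (y i : ℝ) := congrFun h 1
    have h2 := congrArg circleFract h1
    rw [circleFract_coe, circleFract_coe, Int.fract_eq_self.2 (hy i hi),
      Int.fract_eq_self.2 (hy j hj)] at h2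
    exact h2.symm
  have hmeas : ∀ i ∈ s, MeasurableSet (horizontalSegment (c i) (δ i) (y i)) := fun i _ =>
    (isCompact_Icc.image (continuous_torusProj_pair (y i))).measurableSet
  calc ENNReal.ofReal (∑ i ∈ s, δ i) ≤ ∑ i ∈ s, ENNReal.ofReal (δ i) := by
        exact Finset.le_sum_of_subadditive _ ENNReal.ofReal_zero.le
          (fun _ _ => ENNReal.ofReal_add_le) s δ
    _ = ∑ i ∈ s, μH[1] (horizontalSegment (c i) (δ i) (y i)) :=
        Finset.sum_congr rfl fun i hi => (hausdorffMeasure_horizontalSegment _ _ (hδ i hi)).symm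
    _ = μH[1] (⋃ i ∈ s, horizontalSegment (c i) (δ i) (y i)) :=
        (measure_biUnion_finset hdisj hmeas).symm
    _ ≤ μH[1] S := measure_mono (iUnion₂_subset hS)

/-- A set is not piecewise `C¹` if for all large `n` it contains horizontal segments of length
`≥ κ / b ^ n` at the heights `(b p + 1) / b ^ (n + 1)` with `p < b ^ n`. -/
theorem not_isPiecewiseC1_of_horizontalSegment_subset {b : ℕ} (hb : 2 ≤ b) {κ : ℝ} (hκ : 0 < κ)
    (hκ' : κ ≤ 1 / 2) {S : Set (UnitAddTorus (Fin 2))} {n₀ : ℕ}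
    (h : ∀ n ≥ n₀, ∀ p < b ^ n,
      ∃ c, horizontalSegment c (κ / b ^ n) ((b * p + 1) / b ^ (n + 1)) ⊆ S) :
    ¬ IsPiecewiseC1 S := by
  intro hS
  have hb0 : (0 : ℝ) < b := by exact_mod_cast (by omega : 0 < b)
  have hb1 : (1 : ℝ) ≤ b := by exact_mod_cast (by omega : 1 ≤ b)
  choose! c hc using h
  have key : ∀ N : ℕ, ENNReal.ofReal (N * κ) ≤ μH[1] S := by
    intro N
    have hsum : (∑ i ∈ (Finset.Ico n₀ (n₀ + N)).sigma fun n => Finset.range (b ^ n),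
        κ / (b : ℝ) ^ i.1) = N * κ := by
      rw [Finset.sum_sigma]
      simp only [Finset.sum_const, Finset.card_range, nsmul_eq_mul]
      rw [Finset.sum_congr rfl (g := fun _ => κ)]
      · simp
      · intro n _
        have : (b : ℝ) ^ n ≠ 0 := by positivity
        push_cast
        field_simp
    rw [← hsum]
    refine sum_le_hausdorffMeasure_of_horizontalSegment_subset
      (c := fun i : (_ : ℕ) × ℕ => c i.1 i.2)
      (y := fun i : (_ : ℕ) × ℕ => ((b : ℝ) * i.2 + 1) / b ^ (i.1 + 1)) _ ?_ ?_ ?_ ?_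
    · rintro ⟨n, p⟩ -
      exact (div_le_self hκ.le (one_le_pow₀ hb1)).trans hκ'
    · rintro ⟨n, p⟩ hi
      simp only [Finset.mem_sigma, Finset.mem_range] at hi
      refine ⟨by positivity, (div_lt_one (by positivity)).2 ?_⟩
      have h1 : (b * p + 1 : ℕ) < b ^ (n + 1) := by
        rw [pow_succ']
        have : b * (p + 1) ≤ b * b ^ n := Nat.mul_le_mul_left b hi.2
        linarith
      exact_mod_cast h1
    · have key : ∀ n p n' p' : ℕ, ((b : ℝ) * p + 1) / b ^ (n + 1) =
          ((b : ℝ) * p' + 1) / b ^ (n' + 1) → n' ≤ n := by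
        intro n p n' p' h
        by_contra hlt
        obtain ⟨k, rfl⟩ : ∃ k, n' = n + 1 + k := ⟨n' - (n + 1), by omega⟩
        rw [div_eq_div_iff (by positivity) (by positivity)] at h
        have h1 : (b * p + 1) * b ^ (n + 1 + k + 1) = (b * p' + 1) * b ^ (n + 1) := by
          exact_mod_cast h
        have h2 : (b * p + 1) * b ^ k * b = b * p' + 1 := by
          refine Nat.eq_of_mul_eq_mul_right (by positivity : 0 < b ^ (n + 1)) ?_
          rw [← h1]; ring
        have h3 : b ∣ b * p' + 1 := ⟨_, h2.symm.trans (mul_comm _ _)⟩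
        have h4 : b ∣ 1 := (Nat.dvd_add_right (dvd_mul_right b p')).1 h3
        have := Nat.le_of_dvd one_pos h4
        omega
      rintro ⟨n, p⟩ - ⟨n', p'⟩ - h
      dsimp only at h
      obtain rfl : n = n' := le_antisymm (key _ _ _ _ h.symm) (key _ _ _ _ h)
      rw [div_left_inj' (by positivity), _root_.add_left_inj, mul_right_inj' hb0.ne'] at h
      obtain rfl : p = p' := by exact_mod_cast h
      rfl
    · rintro ⟨n, p⟩ hi
      simp only [Finset.mem_sigma, Finset.mem_range, Finset.mem_Ico] at hi
      exact hc n hi.1.1 p hi.2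
  have hfin := hS.hausdorffMeasure_lt_top
  obtain ⟨N, hN⟩ := exists_nat_gt ((μH[1] S).toReal / κ)
  have h1 := key N
  rw [ENNReal.ofReal_le_iff_le_toReal hfin.ne] at h1
  rw [div_lt_iff₀ hκ] at hN
  linarith

end Length

theorem exists_tendsto_fract_mul {c : ℝ} (hc : c ≠ 0) (y : ℝ) :
    ∃ p ∈ Icc (0 : ℝ) 1, ∃ q ∈ Icc (0 : ℝ) 1,
      Tendsto (fun x => Int.fract (c * x)) (𝓝[>] y) (𝓝 p) ∧
      Tendsto (fun x => Int.fract (c * x)) (𝓝[<] y) (𝓝 q) ∧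
      ((∀ n : ℤ, c * y ≠ n) → p - q = 0) ∧ ∀ n : ℤ, c * y = n → c⁻¹ * (p - q) = -|c|⁻¹ := by
  have hcont : ∀ s, Tendsto (fun x => c * x) (𝓝[s] y) (𝓝 (c * y)) := fun s =>
    ((continuous_const_mul c).tendsto y).mono_left nhdsWithin_le_nhds
  by_cases h : ∃ n : ℤ, c * y = n
  · obtain ⟨n, hn⟩ := h
    have hn' : ∀ n : ℤ, ¬ ∀ k : ℤ, (n : ℝ) ≠ k := fun n h => h n rfl
    have h0 : (0 : ℝ) ∈ Icc (0 : ℝ) 1 := by simp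
    have h1 : (1 : ℝ) ∈ Icc (0 : ℝ) 1 := by simp
    have hright : Tendsto Int.fract (𝓝[>] (n : ℝ)) (𝓝 0) :=
      (tendsto_fract_right' n).mono_left (nhdsWithin_mono _ Ioi_subset_Ici_self)
    have hleft : Tendsto Int.fract (𝓝[<] (n : ℝ)) (𝓝 1) := tendsto_fract_left' n
    rw [hn] at hcont ⊢
    rcases hc.lt_or_gt with hneg | hpos
    · refine ⟨1, h1, 0, h0, hleft.comp ?_, hright.comp ?_, fun h => absurd h (hn' n),
        fun _ _ => ?_⟩
      · refine tendsto_nhdsWithin_of_tendsto_nhds_of_eventually_within _ (hcont _) ?_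
        filter_upwards [self_mem_nhdsWithin] with x hx
        exact hn ▸ mul_lt_mul_of_neg_left hx hneg
      · refine tendsto_nhdsWithin_of_tendsto_nhds_of_eventually_within _ (hcont _) ?_
        filter_upwards [self_mem_nhdsWithin] with x hx
        exact hn ▸ mul_lt_mul_of_neg_left hx hneg
      · rw [abs_of_neg hneg, inv_neg]; ring
    · refine ⟨0, h0, 1, h1, hright.comp ?_, hleft.comp ?_, fun h => absurd h (hn' n),
        fun _ _ => ?_⟩
      · refine tendsto_nhdsWithin_of_tendsto_nhds_of_eventually_within _ (hcont _) ?_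
        filter_upwards [self_mem_nhdsWithin] with x hx
        exact hn ▸ mul_lt_mul_of_pos_left hx hpos
      · refine tendsto_nhdsWithin_of_tendsto_nhds_of_eventually_within _ (hcont _) ?_
        filter_upwards [self_mem_nhdsWithin] with x hx
        exact hn ▸ mul_lt_mul_of_pos_left hx hpos
      · rw [abs_of_pos hpos]; ring
  · push Not at h
    have hmem : Int.fract (c * y) ∈ Icc (0 : ℝ) 1 :=
      ⟨Int.fract_nonneg _, (Int.fract_lt_one _).le⟩
    have hfr := (continuousAt_fract (h _)).tendsto
    exact ⟨_, hmem, _, hmem, hfr.comp (hcont _), hfr.comp (hcont _), fun _ => sub_self _,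
      fun n hn => absurd hn (h n)⟩

theorem pow_mul_div_eq_intCast_iff {l : ℤ} (hl : l ≠ 0) {j : ℤ} (hj : ¬ l ∣ j) (k n : ℕ) :
    (∃ N : ℤ, (l : ℝ) ^ k * (j / |(l : ℝ)| ^ n) = N) ↔ n ≤ k := by
  have hl' : 0 < |(l : ℝ)| := abs_pos.2 (by exact_mod_cast hl)
  constructor
  · rintro ⟨N, hN⟩
    by_contra hlt
    obtain ⟨r, rfl⟩ : ∃ r, n = k + 1 + r := ⟨n - (k + 1), by omega⟩
    rw [← mul_div_assoc, div_eq_iff (by positivity)] at hN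
    have h1 : l ^ k * j = N * |l| ^ (k + 1 + r) := by exact_mod_cast hN
    have h2 : l ^ k * l ∣ l ^ k * j := by
      rw [h1, ← pow_succ, pow_add |l|]
      refine Dvd.dvd.mul_left (Dvd.dvd.mul_right ?_ _) N
      rw [← abs_pow]
      exact (dvd_abs _ _).2 dvd_rfl
    exact hj ((mul_dvd_mul_iff_left (pow_ne_zero k hl)).1 h2)
  · intro h
    obtain ⟨r, rfl⟩ := Nat.exists_eq_add_of_le h
    rcases abs_choice (l : ℝ) with h | h
    · refine ⟨l ^ r * j, ?_⟩
      rw [h] at hl' ⊢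
      push_cast
      rw [pow_add]
      field_simp
    · refine ⟨(-1) ^ n * l ^ r * j, ?_⟩
      have : (l : ℝ) = -1 * |(l : ℝ)| := by rw [h]; ring
      push_cast
      rw [pow_add]
      nth_rw 1 [this]
      rw [mul_pow]
      field_simp

noncomputable section

/-- The drift has a jump of size comparable to `|l| ^ (-n)` at `j / |l| ^ n`. -/
theorem exists_drift_jump {l m : ℤ} (hl : 2 ≤ |l|) (hm : m ≠ 0) {j : ℤ} (hj : ¬ l ∣ j) (n : ℕ) :
    ∃ v w : ℝ,
      Tendsto (fun y : ℝ => drift l m y) (𝓝[>] (j / |(l : ℝ)| ^ n)) (𝓝 v) ∧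
      Tendsto (fun y : ℝ => drift l m y) (𝓝[<] (j / |(l : ℝ)| ^ n)) (𝓝 w) ∧
      |(l : ℝ)|⁻¹ ^ (n + 1) ≤ |v - w| ∧ |v - w| ≤ 2 * |(m : ℝ)| * |(l : ℝ)|⁻¹ ^ (n + 1) := by
  have hl0 : l ≠ 0 := by rintro rfl; simp at hl
  have hl0' : (l : ℝ) ≠ 0 := by exact_mod_cast hl0
  choose p hp q hq hpt hqt h0 h1 using fun k : ℕ =>
    exists_tendsto_fract_mul (pow_ne_zero k hl0') (j / |(l : ℝ)| ^ n)
  have hfr : ∀ (k : ℕ) (y : ℝ), circleFract (l ^ k • (y : UnitAddCircle)) =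
      Int.fract ((l : ℝ) ^ k * y) := by
    intro k y
    rw [← AddCircle.coe_zsmul, circleFract_coe, zsmul_eq_mul, Int.cast_pow]
  refine ⟨_, _, tendsto_drift hl m (a := p) fun k => ?_, tendsto_drift hl m (a := q) fun k => ?_,
    ?_⟩
  · simpa only [hfr] using hpt k
  · simpa only [hfr] using hqt k
  set β := |(l : ℝ)|⁻¹ with hβ
  have hβ0 : 0 < β := inv_pos.2 (abs_pos.2 hl0')
  have hβ2 : β ≤ 1 / 2 := by simpa [hβ] using norm_inv_le hl
  have hsp := summable_drift hl hp
  have hsq := summable_drift hl hq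
  have hterm : ∀ k, (l : ℝ)⁻¹ ^ k * p k - (l : ℝ)⁻¹ ^ k * q k =
      if n ≤ k then -β ^ k else 0 := by
    intro k
    split_ifs with hk
    · obtain ⟨N, hN⟩ := (pow_mul_div_eq_intCast_iff hl0 hj k n).2 hk
      rw [← mul_sub, inv_pow, h1 k N hN, abs_pow, hβ, inv_pow]
    · rw [← mul_sub, h0 k fun N hN => hk ((pow_mul_div_eq_intCast_iff hl0 hj k n).1 ⟨N, hN⟩),
        mul_zero]
  have hdiff : ∑' k, (l : ℝ)⁻¹ ^ k * p k - ∑' k, (l : ℝ)⁻¹ ^ k * q k =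
      -(β ^ n * (1 - β)⁻¹) := by
    rw [← hsp.tsum_sub hsq, ← (hsp.sub hsq).sum_add_tsum_nat_add n]
    simp only [hterm]
    rw [Finset.sum_eq_zero, zero_add]
    · simp only [Nat.le_add_left, if_true, pow_add, tsum_neg, tsum_mul_right,
        tsum_geometric_of_lt_one hβ0.le (by linarith : β < 1)]
      ring
    · intro k hk
      rw [if_neg (by simpa using hk)]
  have hinv1 : 1 ≤ (1 - β)⁻¹ := (one_le_inv₀ (by linarith)).2 (by linarith)
  have hinv2 : (1 - β)⁻¹ ≤ 2 := by
    rw [inv_le_comm₀ (by linarith) (by norm_num)]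
    linarith
  have hval : |(-(m / l) * ∑' k, (l : ℝ)⁻¹ ^ k * p k) - -(m / l) * ∑' k, (l : ℝ)⁻¹ ^ k * q k| =
      |(m : ℝ)| * β ^ (n + 1) * (1 - β)⁻¹ := by
    have hpos : 0 < β ^ n * (1 - β)⁻¹ := by positivity
    rw [← mul_sub, hdiff, abs_mul, abs_neg, abs_neg, abs_div, div_eq_mul_inv, ← hβ,
      abs_of_pos hpos]
    ring
  have hm1 : 1 ≤ |(m : ℝ)| := by exact_mod_cast Int.one_le_abs hm
  rw [hval]
  refine ⟨?_, ?_⟩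
  · calc β ^ (n + 1) = 1 * β ^ (n + 1) * 1 := by ring
      _ ≤ _ := by gcongr
  · calc _ ≤ |(m : ℝ)| * β ^ (n + 1) * 2 := by gcongr
      _ = _ := by ring

theorem frequently_irrational_nhdsGT (y : ℝ) : ∃ᶠ x in 𝓝[>] y, Irrational x := by
  refine (nhdsGT_basis y).frequently_iff.2 fun a ha => ?_
  obtain ⟨r, hr, h1, h2⟩ := exists_irrational_btwn ha
  exact ⟨r, ⟨h1, h2⟩, hr⟩

theorem frequently_irrational_nhdsLT (y : ℝ) : ∃ᶠ x in 𝓝[<] y, Irrational x := by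
  refine (nhdsLT_basis y).frequently_iff.2 fun a ha => ?_
  obtain ⟨r, hr, h1, h2⟩ := exists_irrational_btwn ha
  exact ⟨r, ⟨h1, h2⟩, hr⟩

theorem circleDigit_coe_of_pos {b : ℤ} (hb : 0 < b) {x : ℝ} (hx : x ∈ Ioo 0 (b : ℝ)⁻¹) :
    circleDigit b x = 0 := by
  have hb' : (1 : ℝ) ≤ b := by exact_mod_cast hb
  have h1 : (b : ℝ) * x < 1 := by
    have := mul_lt_mul_of_pos_left hx.2 (by linarith : (0 : ℝ) < b)
    rwa [mul_inv_cancel₀ (by linarith)] at this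
  have h2 : (b : ℝ)⁻¹ ≤ 1 := inv_le_one_of_one_le₀ hb'
  rw [circleDigit, circleFract_coe, Int.fract_eq_self.2 ⟨hx.1.le, by linarith [hx.2]⟩,
    Int.floor_eq_zero_iff]
  exact ⟨mul_nonneg (by linarith) hx.1.le, h1⟩

theorem circleDigit_coe_of_neg {b : ℤ} (hb : 0 < b) {x : ℝ} (hx : x ∈ Ioo (-(b : ℝ)⁻¹) 0) :
    circleDigit b x = b - 1 := by
  have hb' : (1 : ℝ) ≤ b := by exact_mod_cast hb
  have h1 : -1 < (b : ℝ) * x := by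
    have := mul_lt_mul_of_pos_left hx.1 (by linarith : (0 : ℝ) < b)
    rwa [mul_neg, mul_inv_cancel₀ (by linarith)] at this
  have h2 : (b : ℝ)⁻¹ ≤ 1 := inv_le_one_of_one_le₀ hb'
  have h3 : Int.fract x = x + 1 := by
    refine Int.fract_eq_iff.2 ⟨by linarith [hx.1], by linarith [hx.2], -1, by push_cast; ring⟩
  rw [circleDigit, circleFract_coe, h3, Int.floor_eq_iff]
  push_cast
  constructor <;> nlinarith [hx.2]

theorem isOpen_coe_image {s : Set ℝ} (hs : IsOpen s) :
    IsOpen (((↑) : ℝ → UnitAddCircle) '' s) :=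
  QuotientAddGroup.isOpenMap_coe s hs

theorem torusProj_pair (x y : ℝ) :
    torusProj ![x, y] = ![(x : UnitAddCircle), (y : UnitAddCircle)] := by
  ext i
  fin_cases i <;> rfl

theorem shearCode_not_locally_constant_of_jump {l m : ℤ} (hl : 2 ≤ |l|) {x y v w : ℝ}
    {F F' : Filter ℝ} (hF : F ≤ 𝓝 y) (hF' : F' ≤ 𝓝 y) (hi : ∃ᶠ t in F, Irrational t)
    (hi' : ∃ᶠ t in F', Irrational t) (hv : Tendsto (fun t : ℝ => drift l m t) F (𝓝 v))
    (hw : Tendsto (fun t : ℝ => drift l m t) F' (𝓝 w))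
    (hxv : x - v ∈ Ioo 0 |(l : ℝ)|⁻¹) (hxw : x - w ∈ Ioo (-|(l : ℝ)|⁻¹) 0)
    {V : Set (UnitAddTorus (Fin 2))} (hV : V ∈ 𝓝 (torusProj ![x, y])) :
    ∃ z₁ ∈ shearIrrational l m, ∃ z₂ ∈ shearIrrational l m, z₁ ∈ V ∧ z₂ ∈ V ∧
      shearCode l m z₁ ≠ shearCode l m z₂ := by
  rw [torusProj_pair] at hV
  have hmap : ∀ {F : Filter ℝ}, F ≤ 𝓝 y →
      map ((↑) : ℝ → UnitAddCircle) F ≤ 𝓝 (y : UnitAddCircle) := fun h =>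
    (map_mono h).trans ((AddCircle.continuous_mk' 1).tendsto y)
  have hirr : ∀ {F : Filter ℝ}, (∃ᶠ t in F, Irrational t) →
      ∃ᶠ t in map ((↑) : ℝ → UnitAddCircle) F, t ∈ circleIrrational := fun h =>
    frequently_map.2 (h.mono fun t ht => coe_mem_circleIrrational ht)
  obtain ⟨z₁, hz₁, hV₁, s, hs, hsz⟩ := exists_shearIrrational_near (hmap hF) (hirr hi)
    (tendsto_map'_iff.2 hv) (isOpen_coe_image isOpen_Ioo) (mem_image_of_mem _ hxv) hV
  obtain ⟨z₂, hz₂, hV₂, s', hs', hsz'⟩ := exists_shearIrrational_near (hmap hF') (hirr hi')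
    (tendsto_map'_iff.2 hw) (isOpen_coe_image isOpen_Ioo) (mem_image_of_mem _ hxw) hV
  refine ⟨z₁, hz₁, z₂, hz₂, hV₁, hV₂, fun h => ?_⟩
  have h1 := congrArg Prod.fst h
  simp only [shearCode, ← hsz, ← hsz'] at h1
  rw [← Int.cast_abs] at hs hs'
  rw [circleDigit_coe_of_pos (by omega) hs, circleDigit_coe_of_neg (by omega) hs'] at h1
  omega

theorem shearCode_not_locally_constant_zero {l : ℤ} (hl : 2 ≤ |l|) (m : ℤ) (x : ℝ)
    {V : Set (UnitAddTorus (Fin 2))} (hV : V ∈ 𝓝 (torusProj ![x, 0])) :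
    ∃ z₁ ∈ shearIrrational l m, ∃ z₂ ∈ shearIrrational l m, z₁ ∈ V ∧ z₂ ∈ V ∧
      shearCode l m z₁ ≠ shearCode l m z₂ := by
  obtain ⟨W, hWV, hW, hxW⟩ := mem_nhds_iff.1 hV
  have hb : (0 : ℝ) < |(l : ℝ)|⁻¹ := by
    have : l ≠ 0 := by rintro rfl; simp at hl
    have : (l : ℝ) ≠ 0 := by exact_mod_cast this
    positivity
  have hnear : ∀ᶠ y : ℝ in 𝓝 0, torusProj ![x, y] ∈ W :=
    (lipschitzWith_torusProj.continuous.comp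
      (continuous_pair continuous_const continuous_id)).continuousAt.eventually
      (hW.mem_nhds hxW)
  have key : ∀ s : Set ℝ, IsOpen s → (∃ᶠ y in 𝓝 0, y ∈ s) →
      ∃ z ∈ shearIrrational l m, z ∈ W ∧ ∃ y ∈ s, (y : UnitAddCircle) = z 1 := by
    intro s hs hfr
    obtain ⟨y, hys, hyW⟩ := (hfr.and_eventually hnear).exists
    obtain ⟨z, ⟨hzW, hz⟩, hzG⟩ := (dense_shearIrrational l m).inter_open_nonempty
      (W ∩ (fun z : UnitAddTorus (Fin 2) => z 1) ⁻¹' (((↑) : ℝ → UnitAddCircle) '' s))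
      (hW.inter ((isOpen_coe_image hs).preimage (continuous_apply 1)))
      ⟨_, hyW, y, hys, rfl⟩
    exact ⟨z, hzG, hzW, hz⟩
  have hpos : ∃ᶠ y : ℝ in 𝓝 0, y ∈ Ioo 0 |(l : ℝ)|⁻¹ :=
    (Eventually.frequently (f := 𝓝[>] (0 : ℝ)) (Ioo_mem_nhdsGT hb)).filter_mono
      nhdsWithin_le_nhds
  have hneg : ∃ᶠ y : ℝ in 𝓝 0, y ∈ Ioo (-|(l : ℝ)|⁻¹) 0 :=
    (Eventually.frequently (f := 𝓝[<] (0 : ℝ)) (Ioo_mem_nhdsLT (neg_neg_of_pos hb))).filter_mono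
      nhdsWithin_le_nhds
  obtain ⟨z₁, hz₁, hV₁, s, hs, hsz⟩ := key _ isOpen_Ioo hpos
  obtain ⟨z₂, hz₂, hV₂, s', hs', hsz'⟩ := key _ isOpen_Ioo hneg
  refine ⟨z₁, hz₁, z₂, hz₂, hWV hV₁, hWV hV₂, fun h => ?_⟩
  have h1 := congrArg Prod.snd h
  simp only [shearCode, ← hsz, ← hsz'] at h1
  rw [← Int.cast_abs] at hs hs'
  rw [circleDigit_coe_of_pos (by omega) hs, circleDigit_coe_of_neg (by omega) hs'] at h1
  omega

theorem isC1Arc_horizontal :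
    IsC1Arc ((fun t : ℝ => torusProj ![t / 2, 0]) '' Icc (0 : ℝ) 1) := by
  have hder : ∀ t : ℝ, HasDerivAt (fun t : ℝ => ![t / 2, 0]) ![1 / 2, 0] t := by
    intro t
    refine hasDerivAt_pi.2 fun i => ?_
    fin_cases i
    · exact (hasDerivAt_id t).div_const 2
    · exact hasDerivAt_const t 0
  refine ⟨fun t => ![t / 2, 0], ?_, fun t ht h => ?_, fun s hs t ht h => ?_, rfl⟩
  · refine contDiffOn_pi.2 fun i => ?_
    fin_cases i
    · exact contDiffOn_id.div_const 2
    · exact contDiffOn_const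
  · rw [(hder t).hasDerivWithinAt.derivWithin (uniqueDiffOn_Icc_zero_one t ht)] at h
    have := congrFun h 0
    norm_num at this
  · have h1 : ((s / 2 : ℝ) : UnitAddCircle) = (t / 2 : ℝ) := congrFun h 0
    have h2 := congrArg circleFract h1
    rw [circleFract_coe, circleFract_coe,
      Int.fract_eq_self.2 ⟨by linarith [hs.1], by linarith [hs.2]⟩,
      Int.fract_eq_self.2 ⟨by linarith [ht.1], by linarith [ht.2]⟩] at h2
    linarith

theorem exists_hybrid_upper {l m : ℤ} (hl : 2 ≤ |l|) (hm : m ≠ 0) :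
    ∃ M, IsMarkovPartition (toralEndo !![l, m; 0, l]) M ∧ IsHybrid M := by
  obtain ⟨M, hM, hbd⟩ := exists_isMarkovPartition_upper hl m
  have hl0 : l ≠ 0 := by rintro rfl; simp at hl
  have hb : 2 ≤ l.natAbs := by zify; exact hl
  have hbl : ((l.natAbs : ℕ) : ℝ) = |(l : ℝ)| := by rw [Nat.cast_natAbs, Int.cast_abs]
  have hb2 : (2 : ℝ) ≤ |(l : ℝ)| := by exact_mod_cast hl
  have hb0 : (0 : ℝ) < |(l : ℝ)| := by linarith
  refine ⟨M, hM, ?_, _, isC1Arc_horizontal, ?_⟩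
  · refine not_isPiecewiseC1_of_horizontalSegment_subset hb
      (κ := |(l : ℝ)|⁻¹ ^ 2 / 2) (by positivity) ?_ (n₀ := 2 * m.natAbs) fun n hn p _ => ?_
    · have : |(l : ℝ)|⁻¹ ^ 2 ≤ 1 := pow_le_one₀ (by positivity) (inv_le_one_of_one_le₀ (by linarith))
      linarith
    · have hj : ¬ l ∣ |l| * p + 1 := by
        intro h
        have h1 : l ∣ 1 := (dvd_add_right (((dvd_abs l l).2 dvd_rfl).mul_right _)).1 h
        have := Int.le_of_dvd one_pos ((abs_dvd l 1).2 h1)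
        omega
      obtain ⟨v, w, hv, hw, hlow, hup⟩ := exists_drift_jump hl hm hj (n + 1)
      push_cast at hv hw
      rw [hbl]
      set y := (|(l : ℝ)| * p + 1) / |(l : ℝ)| ^ (n + 1) with hy
      set δ := |(l : ℝ)|⁻¹ ^ 2 / 2 / |(l : ℝ)| ^ n with hδ
      have hδ0 : 0 < δ := by positivity
      have hδ2 : 2 * δ ≤ |v - w| := by
        refine le_of_eq_of_le ?_ hlow
        rw [hδ, div_eq_mul_inv _ (|(l : ℝ)| ^ n), ← inv_pow]
        ring
      have hsmall : |v - w| ≤ |(l : ℝ)|⁻¹ := by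
        refine hup.trans ?_
        have h1 : 2 * |(m : ℝ)| ≤ |(l : ℝ)| ^ (n + 1) := by
          have h2 : (2 * m.natAbs : ℕ) < 2 ^ n := lt_of_le_of_lt hn Nat.lt_two_pow_self
          have h3 : 2 * |(m : ℝ)| < 2 ^ n := by
            rw [← Int.cast_abs, ← Nat.cast_natAbs]
            exact_mod_cast h2
          have h4 : (2 : ℝ) ^ n ≤ |(l : ℝ)| ^ n := pow_le_pow_left₀ (by norm_num) hb2 n
          have h5 : |(l : ℝ)| ^ n ≤ |(l : ℝ)| ^ (n + 1) :=
            pow_le_pow_right₀ (by linarith) (Nat.le_succ n)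
          linarith
        calc _ ≤ |(l : ℝ)| ^ (n + 1) * |(l : ℝ)|⁻¹ ^ (n + 1 + 1) := by gcongr
          _ = |(l : ℝ)|⁻¹ := by
            rw [pow_succ (|(l : ℝ)|⁻¹), inv_pow, mul_inv_cancel_left₀ (by positivity)]
      refine ⟨min v w + δ / 2, ?_⟩
      rintro _ ⟨x, ⟨hx1, hx2⟩, rfl⟩
      refine hbd _ fun V hV => ?_
      rcases le_total v w with hvw | hvw
      · rw [min_eq_left hvw] at hx1 hx2
        rw [abs_of_nonpos (by linarith)] at hδ2 hsmall
        exact shearCode_not_locally_constant_of_jump hl nhdsWithin_le_nhds nhdsWithin_le_nhds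
          (frequently_irrational_nhdsGT y) (frequently_irrational_nhdsLT y) hv hw
          ⟨by linarith, by linarith⟩ ⟨by linarith, by linarith⟩ hV
      · rw [min_eq_right hvw] at hx1 hx2
        rw [abs_of_nonneg (by linarith)] at hδ2 hsmall
        exact shearCode_not_locally_constant_of_jump hl nhdsWithin_le_nhds nhdsWithin_le_nhds
          (frequently_irrational_nhdsLT y) (frequently_irrational_nhdsGT y) hw hv
          ⟨by linarith, by linarith⟩ ⟨by linarith, by linarith⟩ hV
  · rintro _ ⟨t, -, rfl⟩
    exact hbd _ fun V hV => shearCode_not_locally_constant_zero hl m _ hV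

end

theorem mainTheorem4 (A : Matrix (Fin 2) (Fin 2) ℤ) (hA : IsExpandingMatrix A)
    (hdiag : ¬ IsDiagonalizableMatrix A) :
    ∃ M : Set (Set (UnitAddTorus (Fin 2))), IsMarkovPartition (toralEndo A) M ∧ IsHybrid M := by
  obtain ⟨l, m, P, Q, hl, hm, hPQ, hQP, h⟩ := exists_normal_form A hA hdiag
  exact exists_hybrid_of_conj hPQ hQP h (exists_hybrid_upper hl hm)
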